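/- Let $\mathsf{Gr}$ be the category of the real Grassmann algebras $\Lambda_n$ on $n$ odd generators $\tau_1,\dots,\tau_n$ ($n\ge 0$, $\Lambda_0=\mathbb R$) with parity-preserving unital algebra homomorphisms, and let $\varepsilon_\Lambda:\Lambda\to\mathbb R$ be the unique such morphism. Let $\mathcal M$ be a finite-dimensional smooth supermanifold in the functorial sense: a functor from $\mathsf{Gr}$ to Hausdorff manifolds with an atlas of charts onto superdomains in the linear superspaces $\Lambda\mapsto(\Lambda\otimes\mathbb R^{p|q})_{\bar 0}$, whose transition maps are supersmooth (natural in $\Lambda$, smooth, with $\Lambda_{\bar 0}$-linear differentials); morphisms are the natural transformations that are supersmooth in charts. Let $\mathcal P(\Lambda)=\mathrm{Hom}(\Lambda,-)$ be the superpoint of $\Lambda$ and $\underline{\mathrm{Hom}}(\mathcal M,\mathcal M)$ the functor $\Lambda\mapsto \mathrm{Hom}(\mathcal P(\Lambda)\times\mathcal M,\mathcal M)$, $\rho\mapsto(\sigma\mapsto\sigma\circ(\mathcal P(\rho)\times\mathrm{id}_{\mathcal M}))$. A morphism $\varphi:\mathcal P(\Lambda)\times\mathcal M\to\mathcal M$ is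 called invertible if it has a two-sided inverse for the composition $(g,f)\mapsto g\circ(\mathrm{id}_{\mathcal P(\Lambda)}\times f)$, whose unit is the projection to $\mathcal M$. Its underlying morphism $\varphi_{\mathbb R}:\mathcal M\to\mathcal M$ is the image of $\varphi$ under $\underline{\mathrm{Hom}}(\mathcal M,\mathcal M)(\varepsilon_\Lambda)$, where $\mathrm{Hom}(\mathcal P(\mathbb R)\times\mathcal M,\mathcal M)=\mathrm{Hom}(\mathcal M,\mathcal M)$. **Theorem.** Let $\Lambda=\Lambda_n$ and let $\varphi:\mathcal P(\Lambda)\times\mathcal M\to\mathcal M$ be a morphism. (1) $\varphi$ is invertible if and only if $\varphi_{\mathbb R}$ is an isomorphism of supermanifolds. (2) Suppose that $\varphi_{\mathbb R}$ is invertible. Write $\phi:C^\infty(\mathcal M)\to C^\infty(\mathcal P(\Lambda)\times\mathcal M)\cong\Lambda\otimes C^\infty(\mathcal M)$ and $\phi_0:C^\infty(\mathcal M)\to C^\infty(\mathcal M)$ for the algebra homomorphisms $f\mapsto f\circ\varphi$ and $f\mapsto f\circ\varphi_{\mathbb R}$. There are vector fields (superderivations of $C^\infty(\mathcal M)$) $X_I$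 of parity $|I|$, indexed by the nonempty subsets $I\subseteq\{1,\dots,n\}$, such that, with $\tau_I$ the product of the $\tau_i$, $i\in I$, in increasing order, $$\phi=\exp\Big(\sum_{I}\tau_I X_I\Big)\circ\phi_0,$$ and for every such family $(X_I)$ the algebra homomorphism $\phi^{-1}:C^\infty(\mathcal M)\to\Lambda\otimes C^\infty(\mathcal M)$ given by the inverse of $\varphi$ is $$\phi^{-1}=\phi_0^{-1}\circ\exp\Big(-\sum_{I}\tau_I X_I\Big),$$ where $\phi_0^{-1}$ is extended $\Lambda$-linearly to $\Lambda\otimes C^\infty(\mathcal M)$. (3) Consequently, let $\mathrm{SDiff}(\mathcal M)\subseteq\underline{\mathrm{Hom}}(\mathcal M,\mathcal M)$ be the subfunctor of invertible morphisms and $\mathrm{Aut}(\mathcal M)\subseteq\underline{\mathrm{Hom}}(\mathcal M,\mathcal M)(\mathbb R)$ the set of automorphisms of $\mathcal M$. Then $\mathrm{SDiff}(\mathcal M)$ is the restriction of $\underline{\mathrm{Hom}}(\mathcal M,\mathcal M)$ to $\mathrm{Aut}(\mathcal M)$: $\mathrm{SDiff}(\mathcal M)(\Lambda)=\{\varphi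 \mid \underline{\mathrm{Hom}}(\mathcal M,\mathcal M)(\varepsilon_\Lambda)(\varphi)\in\mathrm{Aut}(\mathcal M)\}$ for all $\Lambda$. -/

import Mathlib

open CategoryTheory Topology
open scoped ContDiff TensorProduct

universe u v w

noncomputable section

namespace SuperGeo

/-! ### Grassmann algebras -/

/-- The Grassmann algebra `Λ_n`: the free supercommutative real algebra on `n` odd generators. -/
abbrev Grassmann (n : ℕ) : Type := ExteriorAlgebra ℝ (Fin n → ℝ)

/-- The homogeneous part of `Λ_n` of parity `i`: even for `i = 0`, odd for `i = 1`. -/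
abbrev part (n : ℕ) (i : ZMod 2) : Submodule ℝ (Grassmann n) :=
  CliffordAlgebra.evenOdd (0 : QuadraticForm ℝ (Fin n → ℝ)) i

/-- The even part of `Λ_n`, as a subalgebra. -/
abbrev EvenPart (n : ℕ) : Subalgebra ℝ (Grassmann n) :=
  CliffordAlgebra.even (0 : QuadraticForm ℝ (Fin n → ℝ))

/-- The odd generators `τ_1, …, τ_n` of `Λ_n`. -/
def gen {n : ℕ} (j : Fin n) : Grassmann n := ExteriorAlgebra.ι ℝ (Pi.single j 1)

/-- The monomial `τ_I`: the product of the `τ_i`, `i ∈ I`, in increasing order. -/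
def tau {n : ℕ} (I : Finset (Fin n)) : Grassmann n :=
  ((I.sort (· ≤ ·)).map gen).prod

theorem gen_mem {n : ℕ} (j : Fin n) : gen j ∈ part n 1 :=
  CliffordAlgebra.ι_mem_evenOdd_one _ _

/-- Coordinates of an element of `Λ_n` with respect to the monomials in the generators. -/
def coords (n : ℕ) : Grassmann n ≃ₗ[ℝ] (Finset (Fin n) → ℝ) :=
  ((Pi.basisFun ℝ (Fin n)).ExteriorAlgebra).equivFun

/-- `Λ_n` is a finite-dimensional real vector space; we norm it by the largest coefficient. Only
the (unique) vector space topology and the resulting notion of smoothness matter below. -/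
instance instNormedAddCommGroupGrassmann (n : ℕ) : NormedAddCommGroup (Grassmann n) :=
  NormedAddCommGroup.induced (Grassmann n) (Finset (Fin n) → ℝ) (coords n) (coords n).injective

instance instNormedSpaceGrassmann (n : ℕ) : NormedSpace ℝ (Grassmann n) :=
  NormedSpace.induced ℝ (Grassmann n) (Finset (Fin n) → ℝ) (coords n)

instance instFiniteGrassmann (n : ℕ) : Module.Finite ℝ (Grassmann n) :=
  Module.Finite.equiv (coords n).symm

theorem mem_even_iff {n : ℕ} {a : Grassmann n} : a ∈ EvenPart n ↔ a ∈ part n 0 := Iff.rfl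

theorem gen_mul_gen_swap {n : ℕ} (v w : Fin n → ℝ) :
    ExteriorAlgebra.ι ℝ v * ExteriorAlgebra.ι ℝ w =
      - (ExteriorAlgebra.ι ℝ w * ExteriorAlgebra.ι ℝ v) :=
  eq_neg_of_add_eq_zero_left (ExteriorAlgebra.ι_add_mul_swap v w)

/-- Even elements are central. -/
theorem even_comm {n : ℕ} {a : Grassmann n} (ha : a ∈ part n 0) (b : Grassmann n) :
    a * b = b * a := by
  have key : ∀ v : Fin n → ℝ, ExteriorAlgebra.ι ℝ v * a = a * ExteriorAlgebra.ι ℝ v := by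
    intro v
    induction a, ha using CliffordAlgebra.even_induction with
    | algebraMap r => exact (Algebra.commutes r _).symm
    | add x y hx hy ihx ihy => rw [mul_add, add_mul, ihx, ihy]
    | ι_mul_ι_mul m₁ m₂ x hx ih =>
      have h1 := gen_mul_gen_swap v m₁
      have h2 := gen_mul_gen_swap v m₂
      calc ExteriorAlgebra.ι ℝ v * (ExteriorAlgebra.ι ℝ m₁ * ExteriorAlgebra.ι ℝ m₂ * x)
          = (ExteriorAlgebra.ι ℝ v * ExteriorAlgebra.ι ℝ m₁) * ExteriorAlgebra.ι ℝ m₂ * x := by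
            simp only [mul_assoc]
        _ = - (ExteriorAlgebra.ι ℝ m₁ * (ExteriorAlgebra.ι ℝ v * ExteriorAlgebra.ι ℝ m₂) * x) := by
            rw [h1]; simp only [neg_mul, mul_assoc]
        _ = ExteriorAlgebra.ι ℝ m₁ * ExteriorAlgebra.ι ℝ m₂ * (ExteriorAlgebra.ι ℝ v * x) := by
            rw [h2]; simp only [neg_mul, mul_neg, neg_neg, mul_assoc]
        _ = _ := by rw [ih]; simp only [mul_assoc]
  induction b using ExteriorAlgebra.induction with
  | algebraMap r => exact (Algebra.commutes r _).symm
  | ι v => exact (key v).symm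
  | mul x y hx hy => rw [← mul_assoc, hx, mul_assoc, hy, mul_assoc]
  | add x y hx hy => rw [mul_add, add_mul, hx, hy]

/-- Odd elements anticommute. -/
theorem odd_anticomm {n : ℕ} {a b : Grassmann n} (ha : a ∈ part n 1) (hb : b ∈ part n 1) :
    a * b = - (b * a) := by
  have key : ∀ v : Fin n → ℝ, ExteriorAlgebra.ι ℝ v * b = - (b * ExteriorAlgebra.ι ℝ v) := by
    intro v
    induction b, hb using CliffordAlgebra.odd_induction with
    | ι w => exact gen_mul_gen_swap v w
    | add x y hx hy ihx ihy => rw [mul_add, add_mul, ihx, ihy, neg_add]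
    | ι_mul_ι_mul m₁ m₂ x hx ih =>
      have h := even_comm (CliffordAlgebra.ι_mul_ι_mem_evenOdd_zero
        (0 : QuadraticForm ℝ (Fin n → ℝ)) m₁ m₂) (ExteriorAlgebra.ι ℝ v)
      rw [← mul_assoc, ← h, mul_assoc, ih, mul_neg, mul_assoc (_ * _) x]
  induction a, ha using CliffordAlgebra.odd_induction with
  | ι w => exact key w
  | add x y hx hy ihx ihy => rw [mul_add, add_mul, ihx, ihy, neg_add]
  | ι_mul_ι_mul m₁ m₂ x hx ih =>
    have h := even_comm (CliffordAlgebra.ι_mul_ι_mem_evenOdd_zero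
      (0 : QuadraticForm ℝ (Fin n → ℝ)) m₁ m₂) b
    rw [mul_assoc, ih, mul_neg, ← mul_assoc, h, mul_assoc]

theorem odd_sq {n : ℕ} {a : Grassmann n} (ha : a ∈ part n 1) : a * a = 0 := by
  have h := odd_anticomm ha ha
  have h2 : (2 : ℝ) • (a * a) = 0 := by
    rw [two_smul]; nth_rewrite 1 [h]; exact neg_add_cancel _
  exact (smul_eq_zero.mp h2).resolve_left two_ne_zero

/-! ### The category `Gr` -/

/-- Objects of the category of finite-dimensional Grassmann algebras: one `Λ_n` for each `n`. -/
structure Gr where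
  /-- the number of odd generators -/
  gens : ℕ

/-- A parity preserving homomorphism of unital real algebras `Λ_m → Λ_n`. -/
@[ext]
structure GrHom (m n : ℕ) where
  toAlgHom : Grassmann m →ₐ[ℝ] Grassmann n
  map_part : ∀ (i : ZMod 2) (a : Grassmann m), a ∈ part m i → toAlgHom a ∈ part n i

instance : Category.{0} Gr where
  Hom A B := GrHom A.gens B.gens
  id A := ⟨AlgHom.id ℝ _, fun _ _ h => h⟩
  comp f g := ⟨g.toAlgHom.comp f.toAlgHom, fun i a h => g.map_part i _ (f.map_part i a h)⟩

/-- The underlying algebra homomorphism of a morphism of Grassmann algebras. -/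
def Gr.alg {A B : Gr} (ρ : A ⟶ B) : Grassmann A.gens →ₐ[ℝ] Grassmann B.gens :=
  GrHom.toAlgHom ρ

theorem Gr.alg_mem {A B : Gr} (ρ : A ⟶ B) {i : ZMod 2} {a : Grassmann A.gens}
    (h : a ∈ part A.gens i) : Gr.alg ρ a ∈ part B.gens i := GrHom.map_part ρ i a h

@[simp] theorem Gr.alg_id (A : Gr) : Gr.alg (𝟙 A) = AlgHom.id ℝ _ := rfl

@[simp] theorem Gr.alg_comp {A B C : Gr} (ρ : A ⟶ B) (σ : B ⟶ C) :
    Gr.alg (ρ ≫ σ) = (Gr.alg σ).comp (Gr.alg ρ) := rfl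

theorem Gr.hom_ext {A B : Gr} {ρ σ : A ⟶ B} (h : ∀ j, Gr.alg ρ (gen j) = Gr.alg σ (gen j)) :
    ρ = σ := by
  apply GrHom.ext
  apply ExteriorAlgebra.hom_ext
  refine (Pi.basisFun ℝ (Fin A.gens)).ext fun j => ?_
  simp only [Pi.basisFun_apply]
  exact h j

/-- The morphism of Grassmann algebras sending the generators to given odd elements. -/
def Gr.lift {A B : Gr} (x : Fin A.gens → part B.gens 1) : A ⟶ B :=
  GrHom.mk
    (ExteriorAlgebra.lift ℝ ⟨(part B.gens 1).subtype ∘ₗ Fintype.linearCombination ℝ x,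
      fun v => odd_sq (Subtype.property _)⟩)
    (by
      set f := (ExteriorAlgebra.lift ℝ ⟨(part B.gens 1).subtype ∘ₗ Fintype.linearCombination ℝ x,
        fun v => odd_sq (Subtype.property _)⟩) with hf
      have h1 : ∀ v, f (ExteriorAlgebra.ι ℝ v) ∈ part B.gens 1 := fun v => by
        rw [hf, ExteriorAlgebra.lift_ι_apply]; exact Subtype.property _
      have h2 : ∀ m₁ m₂, f (ExteriorAlgebra.ι ℝ m₁ * ExteriorAlgebra.ι ℝ m₂) ∈
          part B.gens 0 := fun m₁ m₂ => by
        rw [map_mul]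
        exact SetLike.mul_mem_graded (A := part B.gens) (i := 1) (j := 1) (h1 _) (h1 _)
      have hadd : ∀ (i : ZMod 2) (a c : Grassmann A.gens), f a ∈ part B.gens i →
          f c ∈ part B.gens i → f (a + c) ∈ part B.gens i := fun i a c ha hc => by
        rw [map_add]; exact Submodule.add_mem _ ha hc
      have hmul : ∀ (i : ZMod 2) (m₁ m₂) (a : Grassmann A.gens), f a ∈ part B.gens i →
          f (ExteriorAlgebra.ι ℝ m₁ * ExteriorAlgebra.ι ℝ m₂ * a) ∈ part B.gens i :=
        fun i m₁ m₂ a ha => by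
          rw [map_mul]
          have := SetLike.mul_mem_graded (A := part B.gens) (h2 m₁ m₂) ha
          rwa [zero_add] at this
      intro i a ha
      fin_cases i
      · induction a, ha using CliffordAlgebra.even_induction with
        | algebraMap r => rw [AlgHom.commutes]; exact SetLike.algebraMap_mem_graded (part B.gens) r
        | add x y hx hy ihx ihy => exact hadd _ _ _ ihx ihy
        | ι_mul_ι_mul m₁ m₂ x hx ih => exact hmul _ _ _ _ ih
      · induction a, ha using CliffordAlgebra.odd_induction with
        | ι v => exact h1 v
        | add x y hx hy ihx ihy => exact hadd _ _ _ ihx ihy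
        | ι_mul_ι_mul m₁ m₂ x hx ih => exact hmul _ _ _ _ ih)

theorem Gr.lift_ι {A B : Gr} (x : Fin A.gens → part B.gens 1) (v : Fin A.gens → ℝ) :
    Gr.alg (Gr.lift x) (ExteriorAlgebra.ι ℝ v) = ∑ j, v j • (x j : Grassmann B.gens) := by
  have h := ExteriorAlgebra.lift_ι_apply ℝ
    ((part B.gens 1).subtype ∘ₗ Fintype.linearCombination ℝ x)
    (fun v => odd_sq (Subtype.property _)) v
  refine Eq.trans h ?_
  simp [Fintype.linearCombination_apply]

@[simp] theorem Gr.lift_gen {A B : Gr} (x : Fin A.gens → part B.gens 1) (j : Fin A.gens) :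
    Gr.alg (Gr.lift x) (gen j) = x j := by
  rw [gen, Gr.lift_ι]
  simp [Pi.single_apply]

/-- The object `Λ_0 = ℝ`. -/
def Gr.real : Gr := ⟨0⟩

/-- The unique morphism `ε_Λ : Λ → ℝ`, which sets all odd generators to zero. -/
def Gr.aug (A : Gr) : A ⟶ Gr.real := Gr.lift fun _ => 0

/-- The unique morphism `c_Λ : ℝ → Λ`. -/
def Gr.unit (A : Gr) : Gr.real ⟶ A := Gr.lift fun j => Fin.elim0 j

theorem Gr.aug_unique {A : Gr} (ρ σ : A ⟶ Gr.real) : ρ = σ := by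
  have h0 : ∀ a : Grassmann 0, a ∈ part 0 1 → a = 0 := by
    intro a ha
    induction a, ha using CliffordAlgebra.odd_induction with
    | ι v => rw [Subsingleton.elim v 0, map_zero]
    | add x y hx hy ihx ihy => rw [ihx, ihy, add_zero]
    | ι_mul_ι_mul m₁ m₂ x hx ih => rw [ih, mul_zero]
  refine Gr.hom_ext fun j => ?_
  rw [h0 _ (Gr.alg_mem ρ (gen_mem j)), h0 _ (Gr.alg_mem σ (gen_mem j))]

theorem Gr.unit_unique {A : Gr} (ρ σ : Gr.real ⟶ A) : ρ = σ :=
  Gr.hom_ext fun j => Fin.elim0 j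

/-! ### Linear superspaces and supersmooth maps -/

section Model

variable {n : ℕ}

/-- An action `act a x = a · x` of the even part `Λ_0̄` of `Λ_n`. -/
class EvenAction (n : ℕ) (E : Type*) where
  act : EvenPart n → E → E

open EvenAction (act)

/-- `Λ_0̄` acts on `Λ` by multiplication. -/
instance instActGrassmann : EvenAction n (Grassmann n) where
  act a x := (a : Grassmann n) * x

/-- `Λ_0̄` acts on each homogeneous part of `Λ` by multiplication. -/
instance instActPart (i : ZMod 2) : EvenAction n (part n i) where
  act a x := ⟨(a : Grassmann n) * x, by
    have := SetLike.mul_mem_graded (A := part n) (mem_even_iff.mp a.2) x.2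
    rwa [zero_add] at this⟩

instance instActPi {ι : Type*} {H : ι → Type*} [∀ k, EvenAction n (H k)] :
    EvenAction n (∀ k, H k) where
  act a x k := EvenAction.act a (x k)

instance instActProd {E F : Type*} [EvenAction n E] [EvenAction n F] :
    EvenAction n (E × F) where
  act a x := (EvenAction.act a x.1, EvenAction.act a x.2)

/-- The `Λ`-points `V̄(Λ) = (Λ ⊗ V)_0̄` of the linear superspace `V = ℝ^{p|q}` whose homogeneous
coordinates are indexed by `ι`, the parity of the coordinate `k` being `par k`: the `k`-th
coordinate of a `Λ`-point is an element of `Λ` of parity `par k`. -/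
abbrev Pt {ι : Type} (par : ι → ZMod 2) (n : ℕ) : Type := ∀ k : ι, part n (par k)

/-- The map `V̄(ρ) : V̄(Λ) → V̄(Λ')` induced by a morphism `ρ : Λ → Λ'`. -/
def Pt.map {ι : Type} (par : ι → ZMod 2) {A B : Gr} (ρ : A ⟶ B) (x : Pt par A.gens) :
    Pt par B.gens := fun k => ⟨Gr.alg ρ (x k), Gr.alg_mem ρ (x k).2⟩

/-- A map between real normed spaces with an action of `Λ_0̄` is supersmooth at `x` if it is
smooth at `x` and its differential at `x` is `Λ_0̄`-linear. -/
structure IsSuperSmoothAt (n : ℕ) {E F : Type*} [NormedAddCommGroup E] [NormedSpace ℝ E]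
    [EvenAction n E] [NormedAddCommGroup F] [NormedSpace ℝ F] [EvenAction n F]
    (f : E → F) (x : E) : Prop where
  contDiffAt : ContDiffAt ℝ ∞ f x
  map_smul : ∀ (a : EvenPart n) (v : E), fderiv ℝ f x (act a v) = act a (fderiv ℝ f x v)

namespace IsSuperSmoothAt

variable {E F G : Type*} [NormedAddCommGroup E] [NormedSpace ℝ E] [EvenAction n E]
  [NormedAddCommGroup F] [NormedSpace ℝ F] [EvenAction n F]
  [NormedAddCommGroup G] [NormedSpace ℝ G] [EvenAction n G]

theorem diff {f : E → F} {x : E} (hf : IsSuperSmoothAt n f x) : DifferentiableAt ℝ f x :=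
  hf.contDiffAt.differentiableAt (by simp)

theorem congr {f g : E → F} {x : E} (hf : IsSuperSmoothAt n f x) (h : g =ᶠ[𝓝 x] f) :
    IsSuperSmoothAt n g x :=
  ⟨hf.contDiffAt.congr_of_eventuallyEq h, fun a v => by rw [h.fderiv_eq]; exact hf.map_smul a v⟩

theorem comp {g : F → G} {f : E → F} (x : E) (hg : IsSuperSmoothAt n g (f x))
    (hf : IsSuperSmoothAt n f x) : IsSuperSmoothAt n (g ∘ f) x :=
  ⟨hg.contDiffAt.comp x hf.contDiffAt, fun a v => by
    rw [fderiv_comp x hg.diff hf.diff]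
    simp only [ContinuousLinearMap.comp_apply, hf.map_smul, hg.map_smul]⟩

theorem of_clm (L : E →L[ℝ] F) (hL : ∀ (a : EvenPart n) v, L (act a v) = act a (L v)) (x : E) :
    IsSuperSmoothAt n L x :=
  ⟨L.contDiff.contDiffAt, fun a v => by rw [L.fderiv]; exact hL a v⟩

theorem prodMk {f : E → F} {g : E → G} {x : E} (hf : IsSuperSmoothAt n f x)
    (hg : IsSuperSmoothAt n g x) : IsSuperSmoothAt n (fun y => (f y, g y)) x :=
  ⟨hf.contDiffAt.prodMk hg.contDiffAt, fun a v => by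
    rw [hf.diff.fderiv_prodMk hg.diff]
    simp only [ContinuousLinearMap.prod_apply, hf.map_smul, hg.map_smul, act]⟩

theorem pi {ι : Type} [Fintype ι] {H : ι → Type*} [∀ k, NormedAddCommGroup (H k)]
    [∀ k, NormedSpace ℝ (H k)] [∀ k, EvenAction n (H k)] {f : E → ∀ k, H k} {x : E}
    (hf : ∀ k, IsSuperSmoothAt n (fun y => f y k) x) : IsSuperSmoothAt n f x :=
  ⟨contDiffAt_pi.2 fun k => (hf k).contDiffAt, fun a v => by
    funext k
    have h := fderiv_pi (𝕜 := ℝ) (φ := fun k y => f y k) (x := x) fun k => (hf k).diff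
    have h' : fderiv ℝ f x = ContinuousLinearMap.pi fun k => fderiv ℝ (fun y => f y k) x := h
    rw [h']
    exact (hf k).map_smul a v⟩

theorem add {f g : E → Grassmann n} {x : E} (hf : IsSuperSmoothAt n f x)
    (hg : IsSuperSmoothAt n g x) : IsSuperSmoothAt n (fun y => f y + g y) x :=
  ⟨hf.contDiffAt.add hg.contDiffAt, fun a v => by
    rw [fderiv_fun_add hf.diff hg.diff]
    simp only [add_apply, hf.map_smul, hg.map_smul]
    exact (mul_add _ _ _).symm⟩

theorem mul {f g : E → Grassmann n} {x : E} (hf : IsSuperSmoothAt n f x)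
    (hg : IsSuperSmoothAt n g x) : IsSuperSmoothAt n (fun y => f y * g y) x := by
  let B : Grassmann n →L[ℝ] Grassmann n →L[ℝ] Grassmann n :=
    (LinearMap.mul ℝ (Grassmann n)).toContinuousBilinearMap
  refine ⟨?_, fun a v => ?_⟩
  · exact B.isBoundedBilinearMap.contDiff.contDiffAt.comp x (hf.contDiffAt.prodMk hg.contDiffAt)
  · have h : fderiv ℝ (fun y => f y * g y) x =
        B.precompR E (f x) (fderiv ℝ g x) + B.precompL E (fderiv ℝ f x) (g x) :=
      B.fderiv_of_bilinear hf.diff hg.diff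
    have hR : ∀ w, B.precompR E (f x) (fderiv ℝ g x) w = f x * fderiv ℝ g x w := fun _ => rfl
    have hL : ∀ w, B.precompL E (fderiv ℝ f x) (g x) w = fderiv ℝ f x w * g x := fun _ => rfl
    have hc := even_comm (mem_even_iff.mp a.2) (f x)
    rw [h]
    simp only [add_apply, hR, hL, hf.map_smul, hg.map_smul, act, mul_add, mul_assoc]
    rw [← mul_assoc (f x), ← hc, mul_assoc]

theorem const (c : F) (hc : ∀ a : EvenPart n, act a (0 : F) = 0) (x : E) :
    IsSuperSmoothAt n (fun _ : E => c) x :=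
  ⟨contDiffAt_const, fun a v => by simp [hc]⟩

end IsSuperSmoothAt

theorem part_smul_zero {i : ZMod 2} (a : EvenPart n) : act a (0 : part n i) = 0 :=
  Subtype.ext (mul_zero _)

theorem superSmooth_val {i : ZMod 2} (x : part n i) :
    IsSuperSmoothAt n (fun y : part n i => (y : Grassmann n)) x :=
  IsSuperSmoothAt.of_clm (part n i).subtypeL (fun _ _ => rfl) x

theorem superSmooth_coord {ι : Type} [Fintype ι] (par : ι → ZMod 2) (k : ι) (x : Pt par n) :
    IsSuperSmoothAt n (fun y : Pt par n => y k) x :=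
  IsSuperSmoothAt.of_clm (ContinuousLinearMap.proj (R := ℝ) (φ := fun k => part n (par k)) k)
    (fun _ _ => rfl) x

/-- A map into a homogeneous part of `Λ` is supersmooth as soon as it is so as a map into `Λ`. -/
theorem superSmooth_of_val {E : Type*} [NormedAddCommGroup E] [NormedSpace ℝ E] [EvenAction n E]
    {i : ZMod 2} {f : E → part n i} {x : E}
    (hf : IsSuperSmoothAt n (fun y => (f y : Grassmann n)) x) : IsSuperSmoothAt n f x := by
  obtain ⟨P, hP⟩ := (part n i).subtype.exists_leftInverse_of_injective
    (LinearMap.ker_eq_bot.2 Subtype.val_injective)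
  let Q : Grassmann n →L[ℝ] part n i := LinearMap.toContinuousLinearMap P
  have hQ : ∀ y : part n i, Q y = y := fun y => LinearMap.congr_fun hP y
  have hfc : ContDiffAt ℝ ∞ f x := by
    have h : f = fun y => Q (f y : Grassmann n) := funext fun y => (hQ _).symm
    rw [h]
    exact Q.contDiff.contDiffAt.comp x hf.contDiffAt
  have hd : DifferentiableAt ℝ f x := hfc.differentiableAt (by simp)
  have hv : ∀ v, ((fderiv ℝ f x v : part n i) : Grassmann n) =
      fderiv ℝ (fun y => (f y : Grassmann n)) x v := fun v => by
    have h := fderiv_comp x (g := (part n i).subtypeL) (f := f)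
      (part n i).subtypeL.differentiableAt hd
    rw [ContinuousLinearMap.fderiv] at h
    exact (DFunLike.congr_fun h v).symm
  refine ⟨hfc, fun a v => Subtype.ext ?_⟩
  have h : ((act a (fderiv ℝ f x v) : part n i) : Grassmann n) =
    (a : Grassmann n) * (fderiv ℝ f x v : part n i) := rfl
  rw [h, hv, hv, hf.map_smul]
  rfl

end Model

/-! ### Supermanifolds -/

/-- A superchart of a functor `F : Gr ⥤ Top`: an isomorphism, natural in `Λ`, of an open subfunctor
of `F` (consisting of the points of `F` whose underlying real point lies in an open set) onto a
superdomain `V̄|_U` in a finite-dimensional linear superspace, `U ⊆ V̄(ℝ)` being open and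
`V̄|_U (Λ)` consisting of the points of `V̄(Λ)` whose underlying real point lies in `U`. -/
structure SuperChart (F : Gr ⥤ TopCat.{u}) where
  /-- the index set of the coordinates -/
  ι : Type
  [fin : Fintype ι]
  /-- the parities of the coordinates -/
  par : ι → ZMod 2
  /-- the components of the chart -/
  hom : ∀ A : Gr, OpenPartialHomeomorph (F.obj A) (Pt par A.gens)
  source_eq : ∀ A, (hom A).source = F.map A.aug ⁻¹' (hom Gr.real).source
  target_eq : ∀ A, (hom A).target = Pt.map par A.aug ⁻¹' (hom Gr.real).target
  natural : ∀ {A B : Gr} (ρ : A ⟶ B) (x : F.obj A), x ∈ (hom A).source →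
    hom B (F.map ρ x) = Pt.map par ρ (hom A x)

attribute [instance] SuperChart.fin

/-- A finite-dimensional smooth supermanifold: a functor from `Gr` to (Hausdorff) spaces, with an
atlas of supercharts whose transition maps are supersmooth; in particular each `M(Λ)` is a smooth
manifold and each `M(ρ)` is smooth. All notions below depend only on the maximal atlas containing
the given one. -/
structure SuperManifold where
  /-- the functor of points -/
  F : Gr ⥤ TopCat.{u}
  t2 : ∀ A : Gr, T2Space (F.obj A)
  /-- the supercharts -/
  atlas : Set (SuperChart F)
  cover : ∀ x : F.obj Gr.real, ∃ c ∈ atlas, x ∈ (c.hom Gr.real).source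
  compat : ∀ c ∈ atlas, ∀ d ∈ atlas, ∀ (A : Gr) (x : F.obj A),
    x ∈ (c.hom A).source → x ∈ (d.hom A).source →
      IsSuperSmoothAt A.gens (d.hom A ∘ (c.hom A).symm) (c.hom A x)

namespace SuperManifold

variable (M : SuperManifold.{u}) (N : SuperManifold.{v}) (P : SuperManifold.{w})

/-- The `Λ`-points of a supermanifold. -/
abbrev Pts (A : Gr) : Type u := M.F.obj A

/-- The map of points induced by a morphism of Grassmann algebras. -/
def mapPts {A B : Gr} (ρ : A ⟶ B) (x : M.Pts A) : M.Pts B := M.F.map ρ x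

@[simp] theorem mapPts_id {A : Gr} (x : M.Pts A) : M.mapPts (𝟙 A) x = x := by
  simp [mapPts]

theorem mapPts_comp {A B C : Gr} (ρ : A ⟶ B) (σ : B ⟶ C) (x : M.Pts A) :
    M.mapPts (ρ ≫ σ) x = M.mapPts σ (M.mapPts ρ x) := by
  simp [mapPts]

theorem continuous_mapPts {A B : Gr} (ρ : A ⟶ B) : Continuous (M.mapPts ρ) :=
  (M.F.map ρ).hom.continuous

theorem exists_chart {A : Gr} (x : M.Pts A) : ∃ c ∈ M.atlas, x ∈ (c.hom A).source := by
  obtain ⟨c, hc, h⟩ := M.cover (M.mapPts A.aug x)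
  exact ⟨c, hc, by rw [c.source_eq]; exact h⟩

variable {M N P}

/-- A morphism of supermanifolds: a natural transformation, continuous in each component, that is
supersmooth in charts. -/
@[ext]
structure Hom (M : SuperManifold.{u}) (N : SuperManifold.{v}) where
  /-- the components -/
  app : ∀ A : Gr, M.Pts A → N.Pts A
  continuous_app : ∀ A, Continuous (app A)
  natural : ∀ {A B : Gr} (ρ : A ⟶ B) (x : M.Pts A),
    app B (M.mapPts ρ x) = N.mapPts ρ (app A x)
  smooth : ∀ c ∈ M.atlas, ∀ d ∈ N.atlas, ∀ (A : Gr) (x : M.Pts A),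
    x ∈ (c.hom A).source → app A x ∈ (d.hom A).source →
      IsSuperSmoothAt A.gens (d.hom A ∘ app A ∘ (c.hom A).symm) (c.hom A x)

/-- Supersmoothness at `x` may be tested with one chart around the image point. -/
theorem smooth_of_chart {A : Gr} {f : M.Pts A → N.Pts A} (hf : Continuous f)
    {c : SuperChart M.F} {x : M.Pts A} (hx : x ∈ (c.hom A).source)
    {d d' : SuperChart N.F} (hd : d ∈ N.atlas) (hd' : d' ∈ N.atlas)
    (hxd : f x ∈ (d.hom A).source) (hxd' : f x ∈ (d'.hom A).source)
    (h : IsSuperSmoothAt A.gens (d'.hom A ∘ f ∘ (c.hom A).symm) (c.hom A x)) :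
    IsSuperSmoothAt A.gens (d.hom A ∘ f ∘ (c.hom A).symm) (c.hom A x) := by
  have hl : (c.hom A).symm (c.hom A x) = x := (c.hom A).left_inv hx
  have h1 := N.compat d' hd' d hd A (f x) hxd' hxd
  have h2 : IsSuperSmoothAt A.gens ((d.hom A ∘ (d'.hom A).symm) ∘
      (d'.hom A ∘ f ∘ (c.hom A).symm)) (c.hom A x) :=
    IsSuperSmoothAt.comp _ (by simpa only [Function.comp_apply, hl] using h1) h
  refine h2.congr ?_
  have hcont : ContinuousAt (f ∘ (c.hom A).symm) (c.hom A x) :=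
    hf.continuousAt.comp ((c.hom A).continuousAt_symm ((c.hom A).map_source hx))
  have hmem : (d'.hom A).source ∈ 𝓝 ((f ∘ (c.hom A).symm) (c.hom A x)) := by
    simp only [Function.comp_apply, hl]
    exact (d'.hom A).open_source.mem_nhds hxd'
  filter_upwards [hcont.preimage_mem_nhds hmem] with y hy
  have hy' : f ((c.hom A).symm y) ∈ (d'.hom A).source := hy
  simp only [Function.comp_apply]
  rw [(d'.hom A).left_inv hy']

namespace Hom

/-- The identity morphism. -/
def id (M : SuperManifold.{u}) : Hom M M where
  app _ x := x
  continuous_app _ := continuous_id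
  natural _ _ := rfl
  smooth c hc d hd A x hx hx' := M.compat c hc d hd A x hx hx'

/-- Composition of morphisms: `g ∘ f`. -/
def comp (g : Hom N P) (f : Hom M N) : Hom M P where
  app A x := g.app A (f.app A x)
  continuous_app A := (g.continuous_app A).comp (f.continuous_app A)
  natural ρ x := by rw [f.natural, g.natural]
  smooth c hc d hd A x hx hx' := by
    obtain ⟨e, he, hxe⟩ := N.exists_chart (f.app A x)
    have hl : (c.hom A).symm (c.hom A x) = x := (c.hom A).left_inv hx
    have h1 := f.smooth c hc e he A x hx hxe
    have h2 := g.smooth e he d hd A (f.app A x) hxe hx'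
    have h3 : IsSuperSmoothAt A.gens ((d.hom A ∘ g.app A ∘ (e.hom A).symm) ∘
        (e.hom A ∘ f.app A ∘ (c.hom A).symm)) (c.hom A x) :=
      IsSuperSmoothAt.comp _ (by simpa only [Function.comp_apply, hl] using h2) h1
    refine h3.congr ?_
    have hcont : ContinuousAt (f.app A ∘ (c.hom A).symm) (c.hom A x) :=
      (f.continuous_app A).continuousAt.comp
        ((c.hom A).continuousAt_symm ((c.hom A).map_source hx))
    have hmem : (e.hom A).source ∈ 𝓝 ((f.app A ∘ (c.hom A).symm) (c.hom A x)) := by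
      simp only [Function.comp_apply, hl]
      exact (e.hom A).open_source.mem_nhds hxe
    filter_upwards [hcont.preimage_mem_nhds hmem] with y hy
    have hy' : f.app A ((c.hom A).symm y) ∈ (e.hom A).source := hy
    simp only [Function.comp_apply]
    rw [(e.hom A).left_inv hy']

end Hom

/-- The category of finite-dimensional supermanifolds. -/
instance : Category SuperManifold.{u} where
  Hom M N := Hom M N
  id M := Hom.id M
  comp f g := Hom.comp g f

/-! ### Products -/

/-- The product of two functors `Gr ⥤ Top`. -/
def prodFunctor (F : Gr ⥤ TopCat.{u}) (G : Gr ⥤ TopCat.{v}) : Gr ⥤ TopCat.{max u v} where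
  obj A := TopCat.of (F.obj A × G.obj A)
  map ρ := TopCat.ofHom ⟨fun x => (F.map ρ x.1, G.map ρ x.2),
    ((F.map ρ).hom.continuous.comp continuous_fst).prodMk
      ((G.map ρ).hom.continuous.comp continuous_snd)⟩
  map_id A := by ext x <;> simp
  map_comp ρ σ := by ext x <;> simp

/-- `V̄(Λ) × W̄(Λ)` is the space of `Λ`-points of the superspace `V ⊕ W`. -/
def joinPt {ι κ : Type} (par : ι → ZMod 2) (par' : κ → ZMod 2) (n : ℕ) :
    (Pt par n × Pt par' n) ≃ₜ Pt (Sum.elim par par') n :=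
  (Homeomorph.sumPiEquivProdPi ι κ (fun k => part n (Sum.elim par par' k))).symm

/-- The product of two charts. -/
def prodChart {F : Gr ⥤ TopCat.{u}} {G : Gr ⥤ TopCat.{v}}
    (c : SuperChart F) (d : SuperChart G) : SuperChart (prodFunctor F G) where
  ι := c.ι ⊕ d.ι
  par := Sum.elim c.par d.par
  hom A := ((c.hom A).prod (d.hom A)).transHomeomorph (joinPt c.par d.par A.gens)
  source_eq A := by
    ext x
    have h : x ∈ (c.hom A).source ×ˢ (d.hom A).source ↔
      (F.map A.aug x.1, G.map A.aug x.2) ∈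
        (c.hom Gr.real).source ×ˢ (d.hom Gr.real).source := by
      rw [c.source_eq A, d.source_eq A]; rfl
    exact h
  target_eq A := by
    ext x
    have h : ((joinPt c.par d.par A.gens).symm x) ∈ (c.hom A).target ×ˢ (d.hom A).target ↔
      ((joinPt c.par d.par Gr.real.gens).symm (Pt.map _ A.aug x)) ∈
        (c.hom Gr.real).target ×ˢ (d.hom Gr.real).target := by
      rw [c.target_eq A, d.target_eq A]; rfl
    exact h
  natural {A B} ρ x hx := by
    have hx' : x.1 ∈ (c.hom A).source ∧ x.2 ∈ (d.hom A).source := hx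
    have h1 := c.natural ρ x.1 hx'.1
    have h2 := d.natural ρ x.2 hx'.2
    have h : joinPt c.par d.par B.gens (c.hom B (F.map ρ x.1), d.hom B (G.map ρ x.2)) =
        Pt.map _ ρ (joinPt c.par d.par A.gens (c.hom A x.1, d.hom A x.2)) := by
      rw [h1, h2]
      funext k
      cases k <;> rfl
    exact h

/-- A map into a product is supersmooth in a product chart if both components are. -/
theorem superSmooth_join {n : ℕ} {E : Type*} [NormedAddCommGroup E] [NormedSpace ℝ E]
    [EvenAction n E] {ι κ : Type} [Fintype ι] [Fintype κ] {par : ι → ZMod 2}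
    {par' : κ → ZMod 2} {f : E → Pt par n} {g : E → Pt par' n} {x : E}
    (hf : IsSuperSmoothAt n f x) (hg : IsSuperSmoothAt n g x) :
    IsSuperSmoothAt n (fun y => joinPt par par' n (f y, g y)) x := by
  refine IsSuperSmoothAt.pi fun k => ?_
  cases k with
  | inl k =>
    exact IsSuperSmoothAt.comp (n := n) (g := fun y : Pt par n => y k) x
      (superSmooth_coord par k _) hf
  | inr k =>
    exact IsSuperSmoothAt.comp (n := n) (g := fun y : Pt par' n => y k) x
      (superSmooth_coord par' k _) hg

theorem superSmooth_fst {n : ℕ} {ι κ : Type} [Fintype ι] [Fintype κ] (par : ι → ZMod 2)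
    (par' : κ → ZMod 2) (x : Pt (Sum.elim par par') n) :
    IsSuperSmoothAt n (fun y => ((joinPt par par' n).symm y).1) x :=
  IsSuperSmoothAt.pi fun k => superSmooth_coord (Sum.elim par par') (Sum.inl k) x

theorem superSmooth_snd {n : ℕ} {ι κ : Type} [Fintype ι] [Fintype κ] (par : ι → ZMod 2)
    (par' : κ → ZMod 2) (x : Pt (Sum.elim par par') n) :
    IsSuperSmoothAt n (fun y => ((joinPt par par' n).symm y).2) x :=
  IsSuperSmoothAt.pi fun k => superSmooth_coord (Sum.elim par par') (Sum.inr k) x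

theorem smooth_fst_aux {F : Gr ⥤ TopCat.{u}} {G : Gr ⥤ TopCat.{v}} {κ : Type} [Fintype κ]
    {q : κ → ZMod 2} {A : Gr} (c : SuperChart F) (d : SuperChart G)
    (x : F.obj A × G.obj A) (f : F.obj A → Pt q A.gens)
    (hf : IsSuperSmoothAt A.gens (f ∘ (c.hom A).symm) (c.hom A x.1)) :
    IsSuperSmoothAt A.gens
      (fun y => f (((prodChart c d).hom A).symm y : F.obj A × G.obj A).1)
      ((prodChart c d).hom A x) := by
  refine IsSuperSmoothAt.comp (g := f ∘ (c.hom A).symm)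
    (f := fun y => ((joinPt c.par d.par A.gens).symm y).1) _ ?_ (superSmooth_fst _ _ _)
  exact hf

theorem smooth_snd_aux {F : Gr ⥤ TopCat.{u}} {G : Gr ⥤ TopCat.{v}} {κ : Type} [Fintype κ]
    {q : κ → ZMod 2} {A : Gr} (c : SuperChart F) (d : SuperChart G)
    (x : F.obj A × G.obj A) (f : G.obj A → Pt q A.gens)
    (hf : IsSuperSmoothAt A.gens (f ∘ (d.hom A).symm) (d.hom A x.2)) :
    IsSuperSmoothAt A.gens
      (fun y => f (((prodChart c d).hom A).symm y : F.obj A × G.obj A).2)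
      ((prodChart c d).hom A x) := by
  refine IsSuperSmoothAt.comp (g := f ∘ (d.hom A).symm)
    (f := fun y => ((joinPt c.par d.par A.gens).symm y).2) _ ?_ (superSmooth_snd _ _ _)
  exact hf

/-- The product of two supermanifolds, `(M × N)(Λ) = M(Λ) × N(Λ)`. -/
def prod (M : SuperManifold.{u}) (N : SuperManifold.{v}) : SuperManifold.{max u v} where
  F := prodFunctor M.F N.F
  t2 A := by
    have h1 := M.t2 A
    have h2 := N.t2 A
    exact inferInstanceAs (T2Space (M.F.obj A × N.F.obj A))
  atlas := {e | ∃ c ∈ M.atlas, ∃ d ∈ N.atlas, e = prodChart c d}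
  cover x := by
    obtain ⟨c, hc, hxc⟩ := M.cover x.1
    obtain ⟨d, hd, hxd⟩ := N.cover x.2
    exact ⟨_, ⟨c, hc, d, hd, rfl⟩, ⟨hxc, hxd⟩⟩
  compat := by
    rintro _ ⟨c, hc, d, hd, rfl⟩ _ ⟨c', hc', d', hd', rfl⟩ A x ⟨hxc, hxd⟩ ⟨hxc', hxd'⟩
    exact superSmooth_join
      (smooth_fst_aux c d x (c'.hom A) (M.compat c hc c' hc' A x.1 hxc hxc'))
      (smooth_snd_aux c d x (d'.hom A) (N.compat d hd d' hd' A x.2 hxd hxd'))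

namespace Hom

/-- The projection `M × N → M`. -/
def fst (M : SuperManifold.{u}) (N : SuperManifold.{v}) : Hom (prod M N) M where
  app A x := x.1
  continuous_app A := continuous_fst
  natural ρ x := rfl
  smooth := by
    rintro _ ⟨c, hc, d, hd, rfl⟩ c' hc' A x ⟨hxc, hxd⟩ hxc'
    exact smooth_fst_aux c d x (c'.hom A) (M.compat c hc c' hc' A x.1 hxc hxc')

/-- The projection `M × N → N`. -/
def snd (M : SuperManifold.{u}) (N : SuperManifold.{v}) : Hom (prod M N) N where
  app A x := x.2
  continuous_app A := continuous_snd
  natural ρ x := rfl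
  smooth := by
    rintro _ ⟨c, hc, d, hd, rfl⟩ d' hd' A x ⟨hxc, hxd⟩ hxd'
    exact smooth_snd_aux c d x (d'.hom A) (N.compat d hd d' hd' A x.2 hxd hxd')

/-- The morphism `(f, g) : P → M × N`. -/
def pair (f : Hom P M) (g : Hom P N) : Hom P (prod M N) where
  app A x := (f.app A x, g.app A x)
  continuous_app A := (f.continuous_app A).prodMk (g.continuous_app A)
  natural ρ x := Prod.ext (f.natural ρ x) (g.natural ρ x)
  smooth := by
    rintro c hc _ ⟨d, hd, d', hd', rfl⟩ A x hx ⟨hxd, hxd'⟩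
    exact superSmooth_join (f.smooth c hc d hd A x hx hxd) (g.smooth c hc d' hd' A x hx hxd')

end Hom

/-! ### Superpoints -/

theorem continuous_ptMap {ι : Type} [Fintype ι] (par : ι → ZMod 2) {A B : Gr} (ρ : A ⟶ B) :
    Continuous (Pt.map par ρ) := by
  refine continuous_pi fun k => Continuous.subtype_mk ?_ _
  exact (LinearMap.continuous_of_finiteDimensional (Gr.alg ρ).toLinearMap).comp
    (continuous_subtype_val.comp (continuous_apply k))

/-- A morphism `Λ → Λ'` is the same thing as the family of (odd) images of the generators of `Λ`;
thus the `Λ'`-points `Hom(Λ, Λ')` of the superpoint `P(Λ)` are those of `ℝ^{0|n}`. -/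
def homEquiv (L A : Gr) : (L ⟶ A) ≃ Pt (fun _ : Fin L.gens => (1 : ZMod 2)) A.gens where
  toFun p k := ⟨Gr.alg p (gen k), Gr.alg_mem p (gen_mem k)⟩
  invFun x := Gr.lift x
  left_inv _ := Gr.hom_ext fun j => Gr.lift_gen _ j
  right_inv x := funext fun k => Subtype.ext (Gr.lift_gen x k)

instance instTopHom (L A : Gr) : TopologicalSpace (L ⟶ A) :=
  TopologicalSpace.induced (homEquiv L A) inferInstance

/-- `Hom(Λ_n, Λ') ≅ (Λ'_1̄)^n` as topological spaces. -/
def homHomeo (L A : Gr) : (L ⟶ A) ≃ₜ Pt (fun _ : Fin L.gens => (1 : ZMod 2)) A.gens :=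
  (homEquiv L A).toHomeomorphOfIsInducing ⟨rfl⟩

/-- The functor of points `Λ' ↦ Hom(Λ, Λ')` of the superpoint `P(Λ)`. -/
def pointFunctor (L : Gr) : Gr ⥤ TopCat.{0} where
  obj A := TopCat.of (L ⟶ A)
  map {A B} ρ := TopCat.ofHom ⟨fun p => p ≫ ρ, by
    refine continuous_induced_rng.2 ?_
    exact (continuous_ptMap _ ρ).comp (homHomeo L A).continuous⟩
  map_id A := by ext p; exact Category.comp_id p
  map_comp ρ σ := by ext p; exact (Category.assoc p ρ σ).symm

/-- The global chart of the superpoint `P(Λ)`. -/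
def pointChart (L : Gr) : SuperChart (pointFunctor L) where
  ι := Fin L.gens
  par _ := 1
  hom A := (homHomeo L A).toOpenPartialHomeomorph
  source_eq _ := rfl
  target_eq _ := rfl
  natural _ _ _ := rfl

/-- The superpoint `P(Λ)`. -/
def superPoint (L : Gr) : SuperManifold.{0} where
  F := pointFunctor L
  t2 A := (homHomeo L A).symm.t2Space
  atlas := {pointChart L}
  cover _ := ⟨_, rfl, trivial⟩
  compat := by
    rintro _ rfl _ rfl A x - -
    refine IsSuperSmoothAt.congr (f := fun y => y)
      (IsSuperSmoothAt.of_clm (ContinuousLinearMap.id ℝ _) (fun _ _ => rfl) _) ?_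
    exact Filter.Eventually.of_forall fun y => (homHomeo L A).apply_symm_apply y

/-- For fixed `a ∈ Λ`, the element `ρ(a) ∈ Λ'` depends supersmoothly on `ρ ∈ Hom(Λ, Λ')`. -/
theorem superSmooth_eval {L A : Gr} (a : Grassmann L.gens)
    (x : Pt (fun _ : Fin L.gens => (1 : ZMod 2)) A.gens) :
    IsSuperSmoothAt A.gens (fun y => Gr.alg (Gr.lift (A := L) (B := A) y) a) x := by
  induction a using ExteriorAlgebra.induction with
  | algebraMap r =>
    simp only [AlgHom.commutes]
    exact IsSuperSmoothAt.const _ (fun a => mul_zero _) x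
  | ι v =>
    let T : Pt (fun _ : Fin L.gens => (1 : ZMod 2)) A.gens →ₗ[ℝ] Grassmann A.gens :=
      ∑ j, v j • ((part A.gens 1).subtype ∘ₗ LinearMap.proj j)
    have hT : ∀ y, Gr.alg (Gr.lift (A := L) (B := A) y) (ExteriorAlgebra.ι ℝ v) =
        LinearMap.toContinuousLinearMap T y := fun y => by
      rw [Gr.lift_ι]
      simp [T]
    simp only [hT]
    refine IsSuperSmoothAt.of_clm _ (fun b w => ?_) x
    have h1 : ∀ w, T w = ∑ j, v j • (w j : Grassmann A.gens) := fun w => by simp [T]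
    change T _ = (b : Grassmann A.gens) * T w
    rw [h1, h1, Finset.mul_sum]
    refine Finset.sum_congr rfl fun j _ => ?_
    rw [mul_smul_comm]
    rfl
  | mul a b ha hb =>
    simp only [map_mul]
    exact ha.mul hb
  | add a b ha hb =>
    simp only [map_add]
    exact ha.add hb

/-- The morphism of superpoints `P(φ) : P(Λ') → P(Λ)` dual to `φ : Λ → Λ'`. -/
def superPointMap {L L' : Gr} (φ : L ⟶ L') : Hom (superPoint L') (superPoint L) where
  app A p := φ ≫ p
  continuous_app A := by
    refine continuous_induced_rng.2 (continuous_pi fun k => Continuous.subtype_mk ?_ _)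
    have h : Continuous fun y => Gr.alg (Gr.lift (A := L') (B := A) y) (Gr.alg φ (gen k)) :=
      continuous_iff_continuousAt.2 fun y => (superSmooth_eval _ y).contDiffAt.continuousAt
    have h2 := h.comp (homHomeo L' A).continuous
    refine h2.congr fun p => ?_
    exact congrArg (fun q => Gr.alg q (Gr.alg φ (gen k))) ((homEquiv L' A).left_inv p)
  natural ρ p := (Category.assoc φ p ρ).symm
  smooth := by
    rintro _ rfl _ rfl A p - -
    exact IsSuperSmoothAt.pi fun k => superSmooth_of_val (superSmooth_eval _ _)

/-- The unique morphism from `M` to the superpoint `P(ℝ)`, which is a terminal object. -/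
def toPoint (M : SuperManifold.{u}) : Hom M (superPoint Gr.real) where
  app A _ := A.unit
  continuous_app A := continuous_const
  natural ρ x := Gr.unit_unique _ _
  smooth := by
    rintro c hc _ rfl A x - -
    exact IsSuperSmoothAt.pi fun k => Fin.elim0 k

/-! ### Inner homs and the diffeomorphism supergroup -/

/-- The functor `Hom(M, N) : Gr → Sets`, `Λ ↦ Hom(P(Λ) × M, N)`, which sends `ρ : Λ → Λ'` to
`σ ↦ σ ∘ (P(ρ) × id_M)`. Its `Λ`-points are the supersmooth morphisms `P(Λ) × M → N`. -/
def innerHom (M N : SuperManifold.{u}) : Gr ⥤ Type u where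
  obj L := Hom (prod (superPoint L) M) N
  map {L L'} ρ := TypeCat.ofHom fun σ =>
    σ.comp (Hom.pair ((superPointMap ρ).comp (Hom.fst _ _)) (Hom.snd _ _))
  map_id L := by
    ext σ A x
    exact congrArg (fun p => σ.app A (p, x.2)) (Category.id_comp x.1)
  map_comp ρ ρ' := by
    ext σ A x
    exact congrArg (fun p => σ.app A (p, x.2)) (Category.assoc ρ ρ' x.1)

variable {L : Gr}

/-- The composition `g ∘ (id_{P(Λ)} × f)` of Λ-points of inner hom functors. -/
def innerComp {M N P : SuperManifold.{u}} (g : Hom (prod (superPoint L) N) P)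
    (f : Hom (prod (superPoint L) M) N) : Hom (prod (superPoint L) M) P :=
  g.comp (Hom.pair (Hom.fst _ _) f)

/-- `g` is inverse to `f ∈ Hom(M, M)(Λ)` with respect to composition of `Λ`-points; the unit is
the projection `P(Λ) × M → M`. -/
def IsInverse {M : SuperManifold.{u}} (f g : Hom (prod (superPoint L) M) M) : Prop :=
  innerComp f g = Hom.snd _ _ ∧ innerComp g f = Hom.snd _ _

/-- `f ∈ Hom(M, M)(Λ)` is invertible if it has an inverse. -/
def IsInvertible {M : SuperManifold.{u}} (f : Hom (prod (superPoint L) M) M) : Prop :=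
  ∃ g, IsInverse f g

theorem IsInverse.map {M : SuperManifold.{u}} {L' : Gr} (ρ : L ⟶ L')
    {f g : (innerHom M M).obj L} (h : IsInverse f g) :
    IsInverse ((innerHom M M).map ρ f) ((innerHom M M).map ρ g) := by
  constructor
  · refine Hom.ext ?_
    funext A x
    exact congrFun (congrFun (congrArg Hom.app h.1) A) (ρ ≫ x.1, x.2)
  · refine Hom.ext ?_
    funext A x
    exact congrFun (congrFun (congrArg Hom.app h.2) A) (ρ ≫ x.1, x.2)

/-- The diffeomorphism supergroup `SDiff(M)`, as a subfunctor of `Hom(M, M)`: its `Λ`-points are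
the invertible elements of `Hom(M, M)(Λ)`. -/
def SDiff (M : SuperManifold.{u}) : Subfunctor (innerHom M M) where
  obj L := {f | IsInvertible f}
  map ρ := by
    rintro f ⟨g, hg⟩
    exact ⟨_, hg.map ρ⟩

/-- The identification `Hom(M, M)(ℝ) = Hom(P(ℝ) × M, M) ≅ Hom(M, M)` with the endomorphisms of
`M` in the category of supermanifolds. -/
def toEnd {M : SuperManifold.{u}} (f : (innerHom M M).obj Gr.real) : M ⟶ M :=
  Hom.comp (M := M) (N := prod (superPoint Gr.real) M) (P := M) f
    (Hom.pair (toPoint M) (Hom.id M))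

/-- The morphism `φ_ℝ : M → M` underlying `φ : P(Λ) × M → M`, i.e. the image of `φ` under
`Hom(M, M)(ε_Λ)`. -/
def underlying {M : SuperManifold.{u}} (φ : (innerHom M M).obj L) : M ⟶ M :=
  toEnd ((innerHom M M).map L.aug φ)

/-- The set `Aut(M) ⊆ Hom(M, M)(ℝ)` of automorphisms of `M`. -/
def AutSet (M : SuperManifold.{u}) : Set ((innerHom M M).obj Gr.real) :=
  {f | IsIso (toEnd f)}

/-- The restriction of a functor `G : Gr → Sets` to a subset `S ⊆ G(ℝ)`: the subfunctor of all
points whose underlying real point lies in `S`. -/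
def restrict (G : Gr ⥤ Type u) (S : Set (G.obj Gr.real)) : Subfunctor G where
  obj L := {x | G.map L.aug x ∈ S}
  map {L L'} ρ := by
    intro x hx
    have h : G.map L'.aug (G.map ρ x) = G.map L.aug x := by
      rw [← Gr.aug_unique (ρ ≫ L'.aug) L.aug]
      simp
    change G.map L'.aug (G.map ρ x) ∈ S
    rw [h]
    exact hx

/-! ### Functions and vector fields -/

/-- The superalgebra `C^∞(M)` of supersmooth functions `M → ℝ^{1|1}`. Since the `Λ`-points of the
linear superspace `ℝ^{1|1}` are `Λ_0̄ ⊕ Λ_1̄ = Λ`, a function is a supersmooth natural family of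
maps `M(Λ) → Λ`; the algebra operations are pointwise. -/
def SmoothFun (M : SuperManifold.{u}) : Subalgebra ℝ (∀ A : Gr, M.Pts A → Grassmann A.gens) where
  carrier := {f | (∀ {A B : Gr} (ρ : A ⟶ B) (x : M.Pts A),
      f B (M.mapPts ρ x) = Gr.alg ρ (f A x)) ∧
    ∀ c ∈ M.atlas, ∀ (A : Gr) (x : M.Pts A), x ∈ (c.hom A).source →
      IsSuperSmoothAt A.gens (f A ∘ (c.hom A).symm) (c.hom A x)}
  mul_mem' := by
    rintro f g ⟨hf, hf'⟩ ⟨hg, hg'⟩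
    refine ⟨fun ρ x => ?_, fun c hc A x hx => (hf' c hc A x hx).mul (hg' c hc A x hx)⟩
    simp only [Pi.mul_apply, hf, hg, map_mul]
  add_mem' := by
    rintro f g ⟨hf, hf'⟩ ⟨hg, hg'⟩
    refine ⟨fun ρ x => ?_, fun c hc A x hx => (hf' c hc A x hx).add (hg' c hc A x hx)⟩
    simp only [Pi.add_apply, hf, hg, map_add]
  algebraMap_mem' r := by
    refine ⟨fun ρ x => ?_, fun c hc A x hx =>
      IsSuperSmoothAt.const (algebraMap ℝ (Grassmann A.gens) r) (fun a => mul_zero _) _⟩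
    simp only [Pi.algebraMap_apply, AlgHom.commutes]

/-- A function is homogeneous of parity `i` if its values are. -/
def IsHomog {M : SuperManifold.{u}} (i : ZMod 2) (f : SmoothFun M) : Prop :=
  ∀ (A : Gr) (x : M.Pts A), f.1 A x ∈ part A.gens i

/-- The algebra homomorphism `φ : C^∞(N) → C^∞(M)`, `f ↦ f ∘ φ`, given by a morphism
`φ : M → N`. -/
def pullback {M : SuperManifold.{u}} {N : SuperManifold.{v}} (φ : Hom M N) :
    SmoothFun N →ₐ[ℝ] SmoothFun M where
  toFun f := ⟨fun A x => f.1 A (φ.app A x),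
    fun ρ x => by
      change f.1 _ (φ.app _ (M.mapPts ρ x)) = _
      rw [φ.natural, f.2.1],
    fun c hc A x hx => by
      obtain ⟨d, hd, hxd⟩ := N.exists_chart (φ.app A x)
      have hl : (c.hom A).symm (c.hom A x) = x := (c.hom A).left_inv hx
      have h1 := φ.smooth c hc d hd A x hx hxd
      have h2 := f.2.2 d hd A (φ.app A x) hxd
      have h3 : IsSuperSmoothAt A.gens ((f.1 A ∘ (d.hom A).symm) ∘
          (d.hom A ∘ φ.app A ∘ (c.hom A).symm)) (c.hom A x) :=
        IsSuperSmoothAt.comp _ (by simpa only [Function.comp_apply, hl] using h2) h1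
      refine h3.congr ?_
      have hcont : ContinuousAt (φ.app A ∘ (c.hom A).symm) (c.hom A x) :=
        (φ.continuous_app A).continuousAt.comp
          ((c.hom A).continuousAt_symm ((c.hom A).map_source hx))
      have hmem : (d.hom A).source ∈ 𝓝 ((φ.app A ∘ (c.hom A).symm) (c.hom A x)) := by
        simp only [Function.comp_apply, hl]
        exact (d.hom A).open_source.mem_nhds hxd
      filter_upwards [hcont.preimage_mem_nhds hmem] with y hy
      have hy' : φ.app A ((c.hom A).symm y) ∈ (d.hom A).source := hy
      simp only [Function.comp_apply]
      rw [(d.hom A).left_inv hy']⟩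
  map_one' := rfl
  map_mul' _ _ := rfl
  map_zero' := rfl
  map_add' _ _ := rfl
  commutes' _ := rfl

/-- A vector field of parity `i` on `M`: a superderivation of parity `i` of `C^∞(M)`, i.e. a
linear map of parity `i` with `X(fg) = X(f) g + (-1)^{i |f|} f X(g)`. -/
structure VectorField (M : SuperManifold.{u}) (i : ZMod 2) where
  toLin : SmoothFun M →ₗ[ℝ] SmoothFun M
  parity : ∀ (j : ZMod 2) (f : SmoothFun M), IsHomog j f → IsHomog (i + j) (toLin f)
  leibniz : ∀ (j : ZMod 2) (f g : SmoothFun M), IsHomog j f →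
    toLin (f * g) = toLin f * g + (-1 : ℝ) ^ (i * j).val • (f * toLin g)

/-- The function `p ↦ p(a)` on the superpoint `P(Λ)` given by an element `a ∈ Λ`. -/
def pointFun (L : Gr) (a : Grassmann L.gens) : SmoothFun (superPoint L) :=
  ⟨fun A p => Gr.alg (show L ⟶ A from p) a, fun ρ p => rfl, by
    rintro _ rfl A p -
    exact superSmooth_eval a _⟩

/-- The identification `Λ ⊗ C^∞(M) ≅ C^∞(P(Λ) × M)`, `a ⊗ f ↦ ((p, x) ↦ p(a) f(x))`. -/
def fromTensor (L : Gr) (M : SuperManifold.{u}) :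
    Grassmann L.gens ⊗[ℝ] SmoothFun M →ₗ[ℝ] SmoothFun (prod (superPoint L) M) :=
  TensorProduct.lift (LinearMap.mk₂ ℝ
    (fun a f => pullback (Hom.fst (superPoint L) M) (pointFun L a) *
      pullback (Hom.snd (superPoint L) M) f)
    (fun a b f => by
      rw [← add_mul, ← map_add]; congr 2; apply Subtype.ext; funext A p; exact map_add _ a b)
    (fun r a f => by
      rw [← smul_mul_assoc, ← map_smul]; congr 2; apply Subtype.ext; funext A p
      exact map_smul _ r a)
    (fun a f g => by rw [map_add, mul_add])
    (fun r a f => by rw [map_smul, mul_smul_comm]))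

/-- A family of vector fields `X_I` of parity `|I|`, indexed by the nonempty sets `I` of generators
of `Λ`. -/
abbrev VectorFieldFamily (L : Gr) (M : SuperManifold.{u}) : Type u :=
  ∀ I : {I : Finset (Fin L.gens) // I.Nonempty}, VectorField M (I.1.card : ZMod 2)

/-- The operator `∑_I τ_I X_I` on `Λ ⊗ C^∞(M)`. By the sign rule `τ_I X_I` sends `a ⊗ f` to
`(-1)^{|I||a|} τ_I a ⊗ X_I f = a τ_I ⊗ X_I f` for homogeneous `a`. -/
def sumOp {M : SuperManifold.{u}} (X : VectorFieldFamily L M) :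
    Module.End ℝ (Grassmann L.gens ⊗[ℝ] SmoothFun M) :=
  ∑ I, TensorProduct.map (LinearMap.mulRight ℝ (tau I.1)) (X I).toLin

/-- The exponential series of an endomorphism `D` of `Λ_n ⊗ C^∞(M)`, for `D ^ (n + 1) = 0`. -/
def expOp {M : SuperManifold.{u}} (D : Module.End ℝ (Grassmann L.gens ⊗[ℝ] SmoothFun M)) :
    Module.End ℝ (Grassmann L.gens ⊗[ℝ] SmoothFun M) :=
  ∑ k ∈ Finset.range (L.gens + 1), ((k.factorial : ℝ)⁻¹) • D ^ k

/-- The algebra homomorphism `C^∞(M) → C^∞(P(Λ) × M) ≅ Λ ⊗ C^∞(M)` given by `φ` has the form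
`exp(∑_I τ_I X_I) ∘ φ_0`, where `φ_0` is the homomorphism given by the underlying morphism. -/
def HasExpForm {M : SuperManifold.{u}} (φ : (innerHom M M).obj L)
    (X : VectorFieldFamily L M) : Prop :=
  ∀ f : SmoothFun M, pullback (M := prod (superPoint L) M) (N := M) φ f =
    fromTensor L M (expOp (sumOp X) (1 ⊗ₜ pullback (M := M) (N := M) (underlying φ) f))

end SuperManifold

end SuperGeo

end

open CategoryTheory Topology
open scoped ContDiff TensorProduct

noncomputable section

namespace SuperGeo

/-! ### Monomials -/

/-! Composing `φ` with the inverse of `φ_ℝ` reduces everything to a morphism `q : P(Λ) × M → M` with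
underlying morphism the identity. For such a `q`, substitution `T : F ↦ ((p, x) ↦ F(p, q(p, x)))` is
unipotent on natural functions.

The reason is a Yoneda argument. Every `(p, x)` over `Λ'` is the image of the generic point of
`P(Λ)` over `Λ' ⊗ Λ`, paired with `x`. Expanding the value there in the monomials `τ_I` gives `F(p,
x) = ∑ p(τ_I) f_I(x)` with natural coefficients `f_I` (`sum_coefFun`), and `f_∅` is the value where
all generators are killed. Since `q` is the identity there, `T - 1` raises the order in the
generators (`Deform.sub_one_mem`), so `(T - 1)^(n+1) = 0`.

Inverse. Hence `T⁻¹ = ∑_{j ≤ n} (1 - T)^j` is a polynomial in `T`. Applied to coordinate functions,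
it writes the inverse of `q` in any chart as a fixed real linear combination of the coordinates of
the iterates of `q`. These iterates stay in the chart because `q` does not move underlying real
points. The formula shows that `q(p, ·)` is bijective with continuous, supersmooth inverse
(`deform_bijective`, `invHom`). Conversely, restricting an inverse of `φ` to the trivial point of
`P(Λ)` inverts `φ_ℝ`.

Exponential form. On `C^∞(P(Λ) × M)` the operator `T` is an algebra endomorphism, and `T^s` is
polynomial in `s`. Its linear coefficient is `log T`. Comparing coefficients in `T^(s+t) = T^s T^t`
gives `exp (log T) = T`, and in `T^s(ab) = T^s(a) T^s(b)` it gives the Leibniz rule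
(`powCoeff_succ`, `powCoeff_one_leibniz`). The fields `X_I` are the `τ_I`-coefficients of `log T` on
functions of `M`.

For an arbitrary family `X` of the required form, the formula for the inverse follows by extending
`φ = exp(D) ∘ φ_0` to a `Λ`-linear identity and cancelling `exp(D) exp(-D) = 1`
(`pullback_inverse`). Only the map `Λ ⊗ C^∞(M) → C^∞(P(Λ) × M)` is used, never its injectivity. -/

theorem tau_eq_basis {n : ℕ} (I : Finset (Fin n)) :
    tau I = (Pi.basisFun ℝ (Fin n)).ExteriorAlgebra I := by
  rw [ExteriorAlgebra.basis_apply]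
  change ((I.sort (· ≤ ·)).map gen).prod = (List.ofFn fun i => ExteriorAlgebra.ι ℝ
    (Pi.basisFun ℝ (Fin n) (I.orderEmbOfFin rfl i))).prod
  congr 1
  refine List.ext_getElem (by simp) fun i h₁ h₂ => ?_
  rw [List.getElem_map, List.getElem_ofFn, gen, Pi.basisFun_apply]
  rfl

theorem gen_mem_range {n : ℕ} (j : Fin n) :
    gen j ∈ LinearMap.range (ExteriorAlgebra.ι ℝ : (Fin n → ℝ) →ₗ[ℝ] Grassmann n) :=
  LinearMap.mem_range_self _ _

theorem tau_mem_pow {n : ℕ} (I : Finset (Fin n)) :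
    tau I ∈ (LinearMap.range (ExteriorAlgebra.ι ℝ : (Fin n → ℝ) →ₗ[ℝ] Grassmann n)) ^ I.card := by
  rw [tau, ← Finset.length_sort (· ≤ ·) (s := I)]
  induction I.sort (· ≤ ·) with
  | nil => simp
  | cons j l ih =>
    rw [List.map_cons, List.prod_cons, List.length_cons, pow_succ']
    exact Submodule.mul_mem_mul (gen_mem_range j) ih

theorem tau_mem_part {n : ℕ} (I : Finset (Fin n)) : tau I ∈ part n (I.card : ZMod 2) := by
  rw [tau, ← Finset.length_sort (· ≤ ·) (s := I)]
  induction I.sort (· ≤ ·) with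
  | nil => simpa using SetLike.one_mem_graded (part n)
  | cons j l ih =>
    rw [List.map_cons, List.prod_cons, List.length_cons, Nat.cast_succ, add_comm]
    exact SetLike.mul_mem_graded (A := part n) (gen_mem j) ih

@[simp] theorem tau_empty {n : ℕ} : tau (∅ : Finset (Fin n)) = 1 := by
  simp [tau]

/-- This power is the `k`-th exterior power, of dimension `n.choose k = 0`. All nilpotence below
comes from here: both filtrations by order in the generators end at this point. -/
theorem eq_zero_of_mem_pow {n k : ℕ} (hk : n < k) {a : Grassmann n}
    (ha : a ∈ (LinearMap.range (ExteriorAlgebra.ι ℝ : (Fin n → ℝ) →ₗ[ℝ] Grassmann n)) ^ k) :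
    a = 0 := by
  have h : Module.finrank ℝ (⋀[ℝ]^k (Fin n → ℝ)) = 0 := by
    rw [exteriorPower.finrank_eq, Module.finrank_fin_fun, Nat.choose_eq_zero_of_lt hk]
  have h2 := Submodule.finrank_eq_zero.1 h
  exact (Submodule.eq_bot_iff _).1 h2 a ha

theorem exists_part_add {n : ℕ} (a : Grassmann n) (i : ZMod 2) :
    ∃ b ∈ part n i, ∃ c ∈ part n (i + 1), b + c = a := by
  have h : part n i ⊔ part n (i + 1) = ⊤ := by
    have h0 := (CliffordAlgebra.evenOdd_isCompl (0 : QuadraticForm ℝ (Fin n → ℝ))).sup_eq_top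
    fin_cases i
    · exact h0
    · exact (sup_comm _ _).trans h0
  exact Submodule.mem_sup.1 (h ▸ Submodule.mem_top : a ∈ part n i ⊔ part n (i + 1))

theorem eq_zero_of_mem_part {n : ℕ} {i : ZMod 2} {a : Grassmann n} (h : a ∈ part n i)
    (h' : a ∈ part n (i + 1)) : a = 0 := by
  have h0 := (CliffordAlgebra.evenOdd_isCompl (0 : QuadraticForm ℝ (Fin n → ℝ))).disjoint
  rw [Submodule.disjoint_def] at h0
  fin_cases i
  · exact h0 a h h'
  · exact h0 a h' h

/-- The sign rule. -/
theorem part_comm {n : ℕ} {i j : ZMod 2} {a b : Grassmann n} (ha : a ∈ part n i)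
    (hb : b ∈ part n j) : a * b = (-1 : ℝ) ^ (i * j).val • (b * a) := by
  by_cases hi : i = 0
  · subst hi; simp [even_comm ha b]
  by_cases hj : j = 0
  · subst hj; simp [even_comm hb a]
  have hi : i = 1 := (by decide : ∀ i : ZMod 2, i ≠ 0 → i = 1) i hi
  have hj : j = 1 := (by decide : ∀ i : ZMod 2, i ≠ 0 → i = 1) j hj
  subst hi hj
  rw [odd_anticomm ha hb]
  simp [ZMod.val_one]

/-! ### Adjoining odd generators -/

/-- `Λ_m ⊗ Λ_n = Λ_{m + n}`. -/
def Gr.sum (A L : Gr) : Gr := ⟨A.gens + L.gens⟩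

/-- The inclusion `Λ_m → Λ_m ⊗ Λ_n`. -/
def Gr.inl (A L : Gr) : A ⟶ A.sum L :=
  Gr.lift fun k => ⟨gen (Fin.castAdd L.gens k), gen_mem _⟩

/-- The inclusion `Λ_n → Λ_m ⊗ Λ_n`. -/
def Gr.inr (A L : Gr) : L ⟶ A.sum L :=
  Gr.lift fun k => ⟨gen (Fin.natAdd A.gens k), gen_mem _⟩

/-- The morphism `Λ_m ⊗ Λ_n → Λ'` with components `ρ` and `p`. -/
def Gr.desc {A L B : Gr} (ρ : A ⟶ B) (p : L ⟶ B) : A.sum L ⟶ B :=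
  Gr.lift (A := A.sum L) (Fin.addCases (motive := fun _ => part B.gens 1)
    (fun k => ⟨Gr.alg ρ (gen k), Gr.alg_mem ρ (gen_mem k)⟩)
    (fun k => ⟨Gr.alg p (gen k), Gr.alg_mem p (gen_mem k)⟩))

@[simp] theorem Gr.inl_desc {A L B : Gr} (ρ : A ⟶ B) (p : L ⟶ B) :
    Gr.inl A L ≫ Gr.desc ρ p = ρ := by
  refine Gr.hom_ext fun j => ?_
  rw [Gr.alg_comp, AlgHom.comp_apply, Gr.inl, Gr.lift_gen, Gr.desc]
  refine (Gr.lift_gen (A := A.sum L) _ _).trans ?_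
  rw [Fin.addCases_left]

@[simp] theorem Gr.inr_desc {A L B : Gr} (ρ : A ⟶ B) (p : L ⟶ B) :
    Gr.inr A L ≫ Gr.desc ρ p = p := by
  refine Gr.hom_ext fun j => ?_
  rw [Gr.alg_comp, AlgHom.comp_apply, Gr.inr, Gr.lift_gen, Gr.desc]
  refine (Gr.lift_gen (A := A.sum L) _ _).trans ?_
  rw [Fin.addCases_right]

/-- The linear map `(a_I) ↦ ∑ τ_I a_I`. -/
def sumMap (A L : Gr) : (Finset (Fin L.gens) → Grassmann A.gens) →ₗ[ℝ]
    Grassmann (A.sum L).gens :=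
  ∑ I, LinearMap.mulLeft ℝ (Gr.alg (Gr.inr A L) (tau I)) ∘ₗ
    (Gr.alg (Gr.inl A L)).toLinearMap ∘ₗ LinearMap.proj I

theorem sumMap_apply (A L : Gr) (a : Finset (Fin L.gens) → Grassmann A.gens) :
    sumMap A L a = ∑ I, Gr.alg (Gr.inr A L) (tau I) * Gr.alg (Gr.inl A L) (a I) := by
  simp [sumMap]

theorem mul_mem_range_sumMap (A L : Gr) (b : Grassmann L.gens) (a : Grassmann A.gens) :
    Gr.alg (Gr.inr A L) b * Gr.alg (Gr.inl A L) a ∈ LinearMap.range (sumMap A L) := by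
  refine ⟨fun I => ((Pi.basisFun ℝ (Fin L.gens)).ExteriorAlgebra.repr b I) • a, ?_⟩
  rw [sumMap_apply]
  nth_rewrite 2 [← (Pi.basisFun ℝ (Fin L.gens)).ExteriorAlgebra.sum_repr b]
  rw [map_sum, Finset.sum_mul]
  refine Finset.sum_congr rfl fun I _ => ?_
  rw [map_smul, map_smul, tau_eq_basis, mul_smul_comm, smul_mul_assoc]

/-- The range contains the scalars and is stable under left multiplication by every generator: one
coming from `L` is absorbed in front of `τ_I`, one coming from `A` passes `τ_I` at the cost of a
sign. Injectivity will then follow from a dimension count. -/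
theorem sumMap_surjective (A L : Gr) : Function.Surjective (sumMap A L) := by
  rw [← LinearMap.range_eq_top, Submodule.eq_top_iff']
  intro x
  induction x using CliffordAlgebra.left_induction with
  | algebraMap r =>
    have := mul_mem_range_sumMap A L 1 (algebraMap ℝ _ r)
    rwa [map_one, one_mul, AlgHom.commutes] at this
  | add x y hx hy => exact Submodule.add_mem _ hx hy
  | ι_mul x v hx =>
    obtain ⟨a, rfl⟩ := hx
    rw [sumMap_apply, Finset.mul_sum]
    refine Submodule.sum_mem _ fun I _ => ?_
    have hv : CliffordAlgebra.ι 0 v = ∑ k, v k • gen k := by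
      have := congrArg (CliffordAlgebra.ι (0 : QuadraticForm ℝ (Fin (A.sum L).gens → ℝ)))
        ((Pi.basisFun ℝ (Fin (A.sum L).gens)).sum_repr v)
      rw [← this, map_sum]
      simp [gen]
    rw [hv, Finset.sum_mul]
    refine Submodule.sum_mem _ fun k _ => ?_
    rw [smul_mul_assoc]
    refine Submodule.smul_mem _ _ ?_
    induction k using Fin.addCases with
    | left k =>
      have h : gen (n := (A.sum L).gens) (Fin.castAdd L.gens k) = Gr.alg (Gr.inl A L) (gen k) := by
        rw [Gr.inl, Gr.lift_gen]
      have h2 := part_comm (Gr.alg_mem (Gr.inl A L) (gen_mem k))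
        (Gr.alg_mem (Gr.inr A L) (tau_mem_part I))
      have h3 : gen (n := (A.sum L).gens) (Fin.castAdd L.gens k) *
          (Gr.alg (Gr.inr A L) (tau I) * Gr.alg (Gr.inl A L) (a I)) =
            (-1 : ℝ) ^ (1 * (I.card : ZMod 2)).val •
            (Gr.alg (Gr.inr A L) (tau I) * Gr.alg (Gr.inl A L) (gen k * a I)) := by
        refine (congrArg (· * _) h).trans ?_
        rw [← mul_assoc, h2, smul_mul_assoc, mul_assoc, ← map_mul]
      exact h3 ▸ Submodule.smul_mem _ _ (mul_mem_range_sumMap A L _ _)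
    | right k =>
      have h : gen (n := (A.sum L).gens) (Fin.natAdd A.gens k) = Gr.alg (Gr.inr A L) (gen k) := by
        rw [Gr.inr, Gr.lift_gen]
      have h3 : gen (n := (A.sum L).gens) (Fin.natAdd A.gens k) *
          (Gr.alg (Gr.inr A L) (tau I) * Gr.alg (Gr.inl A L) (a I)) =
            Gr.alg (Gr.inr A L) (gen k * tau I) * Gr.alg (Gr.inl A L) (a I) := by
        refine (congrArg (· * _) h).trans ?_
        rw [← mul_assoc, map_mul]
      exact h3 ▸ mul_mem_range_sumMap A L _ _

theorem finrank_grassmann (n : ℕ) : Module.finrank ℝ (Grassmann n) = 2 ^ n := by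
  rw [(coords n).finrank_eq, Module.finrank_fintype_fun_eq_card, Fintype.card_finset,
    Fintype.card_fin]

/-- `Λ_{m+n}` is the free `Λ_m`-module on the monomials in the additional generators. -/
def sumEquiv (A L : Gr) : (Finset (Fin L.gens) → Grassmann A.gens) ≃ₗ[ℝ]
    Grassmann (A.sum L).gens :=
  LinearEquiv.ofBijective (sumMap A L) <| by
    have h : Module.finrank ℝ (Finset (Fin L.gens) → Grassmann A.gens) =
        Module.finrank ℝ (Grassmann (A.sum L).gens) := by
      rw [Module.finrank_pi_fintype, finrank_grassmann, finrank_grassmann, Finset.sum_const,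
        Finset.card_univ, Fintype.card_finset, Fintype.card_fin, smul_eq_mul, ← pow_add, add_comm]
      rfl
    exact ⟨(LinearMap.injective_iff_surjective_of_finrank_eq_finrank h).2
      (sumMap_surjective A L), sumMap_surjective A L⟩

theorem sumEquiv_apply (A L : Gr) (a : Finset (Fin L.gens) → Grassmann A.gens) :
    sumEquiv A L a = ∑ I, Gr.alg (Gr.inr A L) (tau I) * Gr.alg (Gr.inl A L) (a I) :=
  sumMap_apply A L a

/-- The coefficient of `τ_I` of an element of `Λ_{m+n}`, an element of `Λ_m`. -/
def coef {A L : Gr} (I : Finset (Fin L.gens)) :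
    Grassmann (A.sum L).gens →ₗ[ℝ] Grassmann A.gens :=
  LinearMap.proj I ∘ₗ (sumEquiv A L).symm.toLinearMap

theorem sum_coef {A L : Gr} (b : Grassmann (A.sum L).gens) :
    ∑ I, Gr.alg (Gr.inr A L) (tau I) * Gr.alg (Gr.inl A L) (coef I b) = b := by
  have := (sumEquiv A L).apply_symm_apply b
  rwa [sumEquiv_apply] at this

theorem coef_sum {A L : Gr} (a : Finset (Fin L.gens) → Grassmann A.gens)
    (I : Finset (Fin L.gens)) :
    coef I (∑ I, Gr.alg (Gr.inr A L) (tau I) * Gr.alg (Gr.inl A L) (a I)) = a I := by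
  rw [← sumEquiv_apply]
  exact congrFun ((sumEquiv A L).symm_apply_apply a) I

/-- The morphism `Gr.desc (ρ ≫ Gr.inl B L) (Gr.inr B L)` is `ρ ⊗ id`: it fixes the monomials and
applies `ρ` to their coefficients. -/
theorem coef_natural {A B L : Gr} (ρ : A ⟶ B) (I : Finset (Fin L.gens))
    (b : Grassmann (A.sum L).gens) :
    coef I (Gr.alg (Gr.desc (ρ ≫ Gr.inl B L) (Gr.inr B L)) b) = Gr.alg ρ (coef I b) := by
  nth_rewrite 1 [← sum_coef b]
  rw [map_sum, ← coef_sum (A := B) (fun I => Gr.alg ρ (coef I b)) I]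
  congr 1
  refine Finset.sum_congr rfl fun J _ => ?_
  rw [map_mul, ← AlgHom.comp_apply, ← AlgHom.comp_apply, ← Gr.alg_comp, ← Gr.alg_comp,
    Gr.inl_desc, Gr.inr_desc, Gr.alg_comp, AlgHom.comp_apply]

/-- Even elements pass `τ_I` without a sign. This linearity is what makes the coefficients of a
supersmooth function supersmooth. -/
theorem coef_even_mul {A L : Gr} {a : Grassmann A.gens} (ha : a ∈ part A.gens 0)
    (I : Finset (Fin L.gens)) (b : Grassmann (A.sum L).gens) :
    coef I (Gr.alg (Gr.inl A L) a * b) = a * coef I b := by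
  nth_rewrite 1 [← sum_coef b]
  rw [← coef_sum (fun I => a * coef I b) I, Finset.mul_sum]
  congr 1
  refine Finset.sum_congr rfl fun J _ => ?_
  rw [← mul_assoc, even_comm (Gr.alg_mem _ ha), mul_assoc, map_mul]

/-- Split each coefficient into a part `c I` of the right parity and a part `d I` of the wrong one.
Then `∑ τ_I d_I` has parity `j + 1`, but it is also the difference of two elements of parity `j`. So
it vanishes, and with it every `d I`. -/
theorem coef_mem_part {A L : Gr} {j : ZMod 2} {b : Grassmann (A.sum L).gens}
    (hb : b ∈ part (A.sum L).gens j) (I : Finset (Fin L.gens)) :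
    coef I b ∈ part A.gens (I.card + j) := by
  choose c hc d hd hcd using fun I : Finset (Fin L.gens) =>
    exists_part_add (coef (A := A) I b) (I.card + j)
  have h2 : ∀ i : ZMod 2, i + i = 0 := by decide
  have hC : ∑ I, Gr.alg (Gr.inr A L) (tau I) * Gr.alg (Gr.inl A L) (c I) ∈
      part (A.sum L).gens j := Submodule.sum_mem _ fun I _ => by
    have := SetLike.mul_mem_graded (A := part (A.sum L).gens)
      (Gr.alg_mem (Gr.inr A L) (tau_mem_part I)) (Gr.alg_mem (Gr.inl A L) (hc I))
    rwa [← add_assoc, h2, zero_add] at this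
  have hD : ∑ I, Gr.alg (Gr.inr A L) (tau I) * Gr.alg (Gr.inl A L) (d I) ∈
      part (A.sum L).gens (j + 1) := Submodule.sum_mem _ fun I _ => by
    have := SetLike.mul_mem_graded (A := part (A.sum L).gens)
      (Gr.alg_mem (Gr.inr A L) (tau_mem_part I)) (Gr.alg_mem (Gr.inl A L) (hd I))
    rwa [← add_assoc, ← add_assoc, h2, zero_add] at this
  have hsum : ∑ I, Gr.alg (Gr.inr A L) (tau I) * Gr.alg (Gr.inl A L) (c I) +
      ∑ I, Gr.alg (Gr.inr A L) (tau I) * Gr.alg (Gr.inl A L) (d I) = b := by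
    rw [← Finset.sum_add_distrib]
    conv_rhs => rw [← sum_coef b]
    refine Finset.sum_congr rfl fun I _ => ?_
    rw [← mul_add, ← map_add, hcd]
  have hD0 : ∑ I, Gr.alg (Gr.inr A L) (tau I) * Gr.alg (Gr.inl A L) (d I) = 0 := by
    refine eq_zero_of_mem_part (i := j) ?_ hD
    rw [← eq_sub_iff_add_eq'] at hsum
    rw [hsum]
    exact Submodule.sub_mem _ hb hC
  have hd0 : d I = 0 := by rw [← coef_sum d I, hD0, map_zero]
  rw [← hcd I, hd0, add_zero]
  exact hc I

/-! ### Natural functions on `P(Λ) × X` -/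

section NaturalFunctions

/-- A functor from `Gr` to sets. -/
structure GrSet where
  pts : Gr → Type u
  map : ∀ {A B : Gr}, (A ⟶ B) → pts A → pts B
  map_id : ∀ {A : Gr} (x : pts A), map (𝟙 A) x = x
  map_comp : ∀ {A B C : Gr} (ρ : A ⟶ B) (σ : B ⟶ C) (x : pts A),
    map (ρ ≫ σ) x = map σ (map ρ x)

/-- Families of maps `X(Λ') → Λ'`. -/
abbrev GrSet.Fun (X : GrSet.{u}) : Type u := ∀ A : Gr, X.pts A → Grassmann A.gens

/-- Families of maps `Hom(Λ, Λ') × X(Λ') → Λ'`. -/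
abbrev GrSet.ParFun (L : Gr) (X : GrSet.{u}) : Type u :=
  ∀ A : Gr, (L ⟶ A) × X.pts A → Grassmann A.gens

variable {L : Gr} {X : GrSet.{u}}

/-- Naturality of a family of maps `X(Λ') → Λ'`. -/
def GrSet.Fun.IsNat (f : X.Fun) : Prop :=
  ∀ {A B : Gr} (ρ : A ⟶ B) (x : X.pts A), f B (X.map ρ x) = Gr.alg ρ (f A x)

/-- Naturality of a family of maps `Hom(Λ, Λ') × X(Λ') → Λ'`. -/
def GrSet.ParFun.IsNat (F : X.ParFun L) : Prop :=
  ∀ {A B : Gr} (ρ : A ⟶ B) (p : L ⟶ A) (x : X.pts A),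
    F B (p ≫ ρ, X.map ρ x) = Gr.alg ρ (F A (p, x))

/-- The coefficient of `τ_I` of a function on `P(Λ) × X`. -/
def coefFun (I : Finset (Fin L.gens)) (F : X.ParFun L) : X.Fun :=
  fun A x => coef I (F (A.sum L) (Gr.inr A L, X.map (Gr.inl A L) x))

/-- Yoneda: `Gr.desc (𝟙 A) p : Λ' ⊗ Λ → Λ'` carries the generic point `(Gr.inr A L, x)` to `(p, x)`,
so naturality transports the monomial expansion at the generic point to one at `(p, x)`. -/
theorem sum_coefFun {F : X.ParFun L} (hF : F.IsNat) (A : Gr) (p : L ⟶ A) (x : X.pts A) :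
    F A (p, x) = ∑ I, Gr.alg p (tau I) * coefFun I F A x := by
  have h := hF (Gr.desc (𝟙 A) p) (Gr.inr A L) (X.map (Gr.inl A L) x)
  rw [← X.map_comp, Gr.inl_desc, Gr.inr_desc, X.map_id,
    ← sum_coef (F (A.sum L) (Gr.inr A L, X.map (Gr.inl A L) x)), map_sum] at h
  rw [h]
  refine Finset.sum_congr rfl fun I _ => ?_
  rw [map_mul, ← AlgHom.comp_apply, ← AlgHom.comp_apply, ← Gr.alg_comp, ← Gr.alg_comp,
    Gr.inl_desc, Gr.inr_desc]
  rfl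

theorem coefFun_natural {F : X.ParFun L} (hF : F.IsNat) (I : Finset (Fin L.gens)) :
    (coefFun I F).IsNat := by
  intro A B ρ x
  rw [coefFun, coefFun, ← coef_natural, ← hF, ← X.map_comp, ← X.map_comp, Gr.inl_desc,
    Gr.inr_desc]

/-- Uniqueness of the expansion: at the generic point it is an expansion in the `τ_I` over `Λ'`,
where coefficients are determined. -/
theorem coefFun_eq {F : X.ParFun L} {f : Finset (Fin L.gens) → X.Fun}
    (hf : ∀ I, (f I).IsNat)
    (h : ∀ A p x, F A (p, x) = ∑ I, Gr.alg p (tau I) * f I A x) (I : Finset (Fin L.gens)) :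
    coefFun I F = f I := by
  funext A x
  rw [coefFun, h, ← coef_sum (fun I => f I A x) I]
  congr 1
  refine Finset.sum_congr rfl fun J _ => ?_
  rw [hf]

/-- The algebra homomorphism which kills all generators. -/
def Gr.triv (L A : Gr) : L ⟶ A := L.aug ≫ A.unit

theorem Gr.triv_real {L : Gr} (p : L ⟶ Gr.real) : p = Gr.triv L Gr.real :=
  Gr.aug_unique _ _

theorem Gr.alg_triv_gen {L A : Gr} (j : Fin L.gens) : Gr.alg (Gr.triv L A) (gen j) = 0 := by
  rw [Gr.triv, Gr.alg_comp, AlgHom.comp_apply, Gr.aug, Gr.lift_gen]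
  exact map_zero _

theorem Gr.alg_triv_tau {L A : Gr} {I : Finset (Fin L.gens)} (hI : I.Nonempty) :
    Gr.alg (Gr.triv L A) (tau I) = 0 := by
  rw [tau, map_list_prod, List.map_map]
  refine List.prod_eq_zero ?_
  obtain ⟨j, hj⟩ := hI
  exact List.mem_map.2 ⟨j, (Finset.mem_sort _).2 hj, Gr.alg_triv_gen j⟩

/-- The trivial point kills every `τ_I` with `I` nonempty, leaving one term of the expansion. -/
theorem coefFun_empty {F : X.ParFun L} (hF : F.IsNat) (A : Gr) (x : X.pts A) :
    coefFun ∅ F A x = F A (Gr.triv L A, x) := by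
  rw [sum_coefFun hF, Finset.sum_eq_single ∅, tau_empty, map_one, one_mul]
  · intro I _ hI
    rw [Gr.alg_triv_tau (Finset.nonempty_iff_ne_empty.2 hI), zero_mul]
  · simp

/-! ### Unipotence -/

/-- Natural families of maps `X → X` parametrized by `P(Λ)`, with underlying map the identity. -/
structure Deform (L : Gr) (X : GrSet.{u}) where
  app : ∀ A : Gr, (L ⟶ A) × X.pts A → X.pts A
  natural : ∀ {A B : Gr} (ρ : A ⟶ B) (p : L ⟶ A) (x : X.pts A),
    app B (p ≫ ρ, X.map ρ x) = X.map ρ (app A (p, x))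
  app_triv : ∀ (A : Gr) (x : X.pts A), app A (Gr.triv L A, x) = x

/-- Composition with `(p, x) ↦ (p, q(p, x))`. -/
def Deform.op (q : Deform L X) : Module.End ℝ (X.ParFun L) where
  toFun F A z := F A (z.1, q.app A z)
  map_add' _ _ := rfl
  map_smul' _ _ := rfl

theorem Deform.op_apply (q : Deform L X) (F : X.ParFun L) (A : Gr) (p : L ⟶ A) (x : X.pts A) :
    q.op F A (p, x) = F A (p, q.app A (p, x)) := rfl

theorem Deform.op_pow_apply (q : Deform L X) (k : ℕ) (F : X.ParFun L) (A : Gr) (p : L ⟶ A)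
    (x : X.pts A) : (q.op ^ k) F A (p, x) = F A (p, (fun y => q.app A (p, y))^[k] x) := by
  induction k generalizing x with
  | zero => rfl
  | succ k ih => rw [pow_succ', Module.End.mul_apply, q.op_apply, ih, Function.iterate_succ_apply]

/-- The functions of order at least `k` in the generators of `Λ`. -/
def filtration (L : Gr) (X : GrSet.{u}) (k : ℕ) : Submodule ℝ (X.ParFun L) :=
  Submodule.span ℝ {F | ∃ i ≥ k, ∃ a ∈ LinearMap.range (ExteriorAlgebra.ι ℝ) ^ i,
    ∃ f : X.Fun, f.IsNat ∧ F = fun A z => Gr.alg z.1 a * f A z.2}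

theorem mem_filtration_zero {F : X.ParFun L} (hF : F.IsNat) : F ∈ filtration L X 0 := by
  have h : F = ∑ I, fun A z => Gr.alg z.1 (tau I) * coefFun I F A z.2 := by
    funext A z
    simp only [Finset.sum_apply]
    exact sum_coefFun hF A z.1 z.2
  rw [h]
  exact Submodule.sum_mem _ fun I _ => Submodule.subset_span
    ⟨_, Nat.zero_le _, _, tau_mem_pow I, _, coefFun_natural hF I, rfl⟩

theorem eq_zero_of_mem_filtration {k : ℕ} (hk : L.gens < k) {F : X.ParFun L}
    (hF : F ∈ filtration L X k) : F = 0 := by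
  induction hF using Submodule.span_induction with
  | mem F h =>
    obtain ⟨i, hi, a, ha, f, hf, rfl⟩ := h
    funext A z
    rw [eq_zero_of_mem_pow (hk.trans_le hi) ha, map_zero, zero_mul]
    rfl
  | zero => rfl
  | add F G _ _ hF hG => rw [hF, hG, add_zero]
  | smul r F _ hF => rw [hF, smul_zero]

/-- On a product `p(a) f(x)` the operator leaves `p(a)` alone and replaces `f` by `g = f ∘ q - f`.
Since `q` is the identity at the trivial point, `g` has no `τ_∅`-term, and every other `τ_I` raises
the order by `|I| ≥ 1`. -/
theorem Deform.sub_one_mem (q : Deform L X) {k : ℕ} {F : X.ParFun L}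
    (hF : F ∈ filtration L X k) : (q.op - 1) F ∈ filtration L X (k + 1) := by
  induction hF using Submodule.span_induction with
  | mem F h =>
    obtain ⟨i, hi, a, ha, f, hf, rfl⟩ := h
    let g : X.ParFun L := fun A z => f A (q.app A z) - f A z.2
    have hg : g.IsNat := fun {A B} ρ p x => by
      change f B (q.app B (p ≫ ρ, X.map ρ x)) - f B (X.map ρ x) =
        Gr.alg ρ (f A (q.app A (p, x)) - f A x)
      rw [q.natural, hf, hf, map_sub]
    have h : (q.op - 1) (fun A z => Gr.alg z.1 a * f A z.2) =
        ∑ I with I.Nonempty, fun A z => Gr.alg z.1 (a * tau I) * coefFun I g A z.2 := by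
      funext A z
      obtain ⟨p, x⟩ := z
      change Gr.alg p a * f A (q.app A (p, x)) - Gr.alg p a * f A x = _
      simp only [Finset.sum_apply]
      rw [← mul_sub]
      change Gr.alg p a * g A (p, x) = _
      rw [sum_coefFun hg, Finset.mul_sum, ← Finset.sum_filter_add_sum_filter_not _ (·.Nonempty),
        add_eq_left.2]
      · exact Finset.sum_congr rfl fun I _ => by rw [map_mul, mul_assoc]
      · refine Finset.sum_eq_zero fun I hI => ?_
        have hI : I = ∅ := by simpa using hI
        subst hI
        rw [coefFun_empty hg]
        change _ * (_ * (f A (q.app A (Gr.triv L A, x)) - f A x)) = 0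
        rw [q.app_triv, sub_self, mul_zero, mul_zero]
    rw [h]
    refine Submodule.sum_mem _ fun I hI => Submodule.subset_span
      ⟨i + I.card, ?_, _, ?_, _, coefFun_natural hg I, rfl⟩
    · exact add_le_add hi (Finset.card_pos.2 (Finset.mem_filter.1 hI).2)
    · rw [pow_add]
      exact Submodule.mul_mem_mul ha (tau_mem_pow I)
  | zero => rw [map_zero]; exact Submodule.zero_mem _
  | add F G _ _ hF hG => rw [map_add]; exact Submodule.add_mem _ hF hG
  | smul r F _ hF => rw [map_smul]; exact Submodule.smul_mem _ _ hF

theorem Deform.sub_one_pow_eq_zero (q : Deform L X) {F : X.ParFun L} (hF : F.IsNat) :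
    ((q.op - 1) ^ (L.gens + 1)) F = 0 := by
  have h : ∀ k, ((q.op - 1) ^ k) F ∈ filtration L X k := fun k => by
    induction k with
    | zero => exact mem_filtration_zero hF
    | succ k ih => rw [pow_succ', Module.End.mul_apply]; exact q.sub_one_mem ih
  exact eq_zero_of_mem_filtration (Nat.lt_succ_self _) (h _)

/-- The polynomial `∑_{j ≤ n} (1 - T)^j`, which inverts `T` modulo `(1 - T)^{n+1}`. -/
def invPoly (n : ℕ) : Polynomial ℝ := ∑ j ∈ Finset.range (n + 1), (1 - Polynomial.X) ^ j

theorem invPoly_mul_X (n : ℕ) :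
    invPoly n * Polynomial.X = 1 - (1 - Polynomial.X) ^ (n + 1) := by
  have h := geom_sum_mul_neg (1 - Polynomial.X : Polynomial ℝ) (n + 1)
  rwa [sub_sub_cancel] at h

/-- Evaluate at `T = 1`. That the weights sum to one keeps the underlying real point fixed when
iterates are combined, so the combination stays in the superdomain. -/
theorem sum_coeff_invPoly (n : ℕ) :
    ∑ i ∈ Finset.range ((invPoly n).natDegree + 1), (invPoly n).coeff i = 1 := by
  have h := congrArg (Polynomial.eval 1) (invPoly_mul_X n)
  rw [Polynomial.eval_mul, Polynomial.eval_eq_sum_range] at h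
  simpa using h

theorem Deform.invPoly_op (q : Deform L X) {F : X.ParFun L} (hF : F.IsNat) (A : Gr) (p : L ⟶ A)
    (x : X.pts A) :
    ∑ i ∈ Finset.range ((invPoly L.gens).natDegree + 1), (invPoly L.gens).coeff i •
      F A (p, (fun y => q.app A (p, y))^[i] (q.app A (p, x))) = F A (p, x) := by
  have h := congrArg (fun P => Polynomial.aeval q.op P F A (p, x)) (invPoly_mul_X L.gens)
  have h0 : ((1 - q.op) ^ (L.gens + 1)) F = 0 := by
    have h1 : (1 - q.op) ^ (L.gens + 1) = (-1) ^ (L.gens + 1) * (q.op - 1) ^ (L.gens + 1) := by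
      rw [← neg_sub q.op 1]; exact neg_pow (q.op - 1) _
    rw [h1, Module.End.mul_apply, q.sub_one_pow_eq_zero hF, map_zero]
  -- With `T` as the outermost factor, `T · P(T) F` at `(p, x)` is `P(T) F` at `(p, q(p, x))`, which
  -- is the left side of the goal.
  simp only [mul_comm _ (Polynomial.X : Polynomial ℝ), map_mul, map_sub, map_one, map_pow,
    Polynomial.aeval_X, Module.End.mul_apply, LinearMap.sub_apply, Module.End.one_apply, h0,
    sub_zero, q.op_apply] at h
  rw [← h, Polynomial.aeval_eq_sum_range]
  simp only [LinearMap.sum_apply, LinearMap.smul_apply, Finset.sum_apply, Pi.smul_apply,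
    q.op_pow_apply]

end NaturalFunctions

/-! ### Inversion in superdomains -/

section Domain

variable {ι : Type} (par : ι → ZMod 2)

theorem ptMap_comp {A B C : Gr} (ρ : A ⟶ B) (σ : B ⟶ C) (y : Pt par A.gens) :
    Pt.map par (ρ ≫ σ) y = Pt.map par σ (Pt.map par ρ y) := rfl

theorem ptMap_sum_smul {A B : Gr} (ρ : A ⟶ B) (s : Finset ℕ) (a : ℕ → ℝ)
    (y : ℕ → Pt par A.gens) :
    Pt.map par ρ (∑ i ∈ s, a i • y i) = ∑ i ∈ s, a i • Pt.map par ρ (y i) := by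
  funext k
  apply Subtype.ext
  simp [Pt.map, Finset.sum_apply, map_sum]

/-- The superdomain over a set of real points. -/
abbrev domain (U : Set (Pt par Gr.real.gens)) : GrSet where
  pts A := {y : Pt par A.gens // Pt.map par A.aug y ∈ U}
  map {A B} ρ y := ⟨Pt.map par ρ y.1, by
    rw [← ptMap_comp, Gr.aug_unique (ρ ≫ B.aug) A.aug]; exact y.2⟩
  map_id _ := rfl
  map_comp _ _ _ := rfl

end Domain

section Deform

variable {L : Gr} {X : GrSet.{u}}

/-- Over `ℝ` the only point of `P(Λ)` is the trivial one, where `q` is the identity. Hence `q`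
preserves every superdomain and every chart domain. -/
theorem Deform.map_aug (q : Deform L X) {A : Gr} (p : L ⟶ A) (x : X.pts A) :
    X.map A.aug (q.app A (p, x)) = X.map A.aug x := by
  rw [← q.natural, Gr.triv_real (p ≫ A.aug), q.app_triv]

variable {ι : Type} {par : ι → ZMod 2} {U : Set (Pt par Gr.real.gens)}

theorem Deform.ptMap_aug_iterate (q : Deform L (domain par U)) {A : Gr} (p : L ⟶ A)
    (y : (domain par U).pts A) (i : ℕ) :
    Pt.map par A.aug ((fun y => q.app A (p, y))^[i] y).1 = Pt.map par A.aug y.1 := by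
  induction i with
  | zero => rfl
  | succ i ih =>
    rw [Function.iterate_succ_apply', ← ih]
    exact congrArg Subtype.val (q.map_aug p _)

theorem Deform.map_iterate (q : Deform L X) {A B : Gr} (ρ : A ⟶ B) (p : L ⟶ A) (x : X.pts A)
    (i : ℕ) : (fun y => q.app B (p ≫ ρ, y))^[i] (X.map ρ x) =
      X.map ρ ((fun y => q.app A (p, y))^[i] x) := by
  induction i with
  | zero => rfl
  | succ i ih => rw [Function.iterate_succ_apply', Function.iterate_succ_apply', ih, q.natural]

theorem Deform.iterate_triv (q : Deform L X) {A : Gr} (x : X.pts A) (i : ℕ) :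
    (fun y => q.app A (Gr.triv L A, y))^[i] x = x :=
  Function.iterate_fixed (q.app_triv A x) i

/-- The coordinates of the inverse of a deformation of a superdomain. -/
def Deform.invVal (q : Deform L (domain par U)) (A : Gr) (z : (L ⟶ A) × (domain par U).pts A) :
    Pt par A.gens :=
  ∑ i ∈ Finset.range ((invPoly L.gens).natDegree + 1), (invPoly L.gens).coeff i •
    ((fun y => q.app A (z.1, y))^[i] z.2).1

theorem Deform.ptMap_aug_invVal (q : Deform L (domain par U)) (A : Gr)
    (z : (L ⟶ A) × (domain par U).pts A) :
    Pt.map par A.aug (q.invVal A z) = Pt.map par A.aug z.2.1 := by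
  simp only [invVal, ptMap_sum_smul, q.ptMap_aug_iterate]
  rw [← Finset.sum_smul, sum_coeff_invPoly, one_smul]

/-- The inverse of a deformation of a superdomain. -/
def Deform.inv (q : Deform L (domain par U)) : Deform L (domain par U) where
  app A z := ⟨q.invVal A z, by rw [q.ptMap_aug_invVal]; exact z.2.2⟩
  natural ρ p x := by
    apply Subtype.ext
    change q.invVal _ _ = Pt.map par ρ (q.invVal _ _)
    simp only [invVal, ptMap_sum_smul, q.map_iterate]
  app_triv A x := by
    apply Subtype.ext
    change q.invVal _ _ = _
    simp only [invVal, q.iterate_triv]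
    rw [← Finset.sum_smul, sum_coeff_invPoly, one_smul]

/-- This is `Deform.invPoly_op` for the coordinate functions, which are natural. -/
theorem Deform.inv_app_app (q : Deform L (domain par U)) (A : Gr) (p : L ⟶ A)
    (y : (domain par U).pts A) : q.inv.app A (p, q.app A (p, y)) = y := by
  apply Subtype.ext
  funext k
  apply Subtype.ext
  have h := q.invPoly_op (F := fun A z => (z.2.1 k : Grassmann A.gens))
    (fun ρ p x => rfl) A p y
  change (q.invVal A _ k : Grassmann A.gens) = _
  rw [← h, invVal]
  simp [Finset.sum_apply]

/-- The left inverse `q.inv` is again a deformation, so it has a left inverse too; a left inverse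
possessing a left inverse is two-sided. -/
theorem Deform.app_inv_app (q : Deform L (domain par U)) (A : Gr) (p : L ⟶ A)
    (y : (domain par U).pts A) : q.app A (p, q.inv.app A (p, y)) = y := by
  have h : q.inv.inv.app A (p, q.inv.app A (p, q.app A (p, q.inv.app A (p, y)))) =
      q.app A (p, q.inv.app A (p, y)) := q.inv.inv_app_app A p _
  rw [q.inv_app_app, q.inv.inv_app_app] at h
  exact h.symm

end Deform

/-! ### Charts -/

namespace SuperChart

variable {F : Gr ⥤ TopCat.{u}} (c : SuperChart F)

theorem map_mem_source {A B : Gr} (ρ : A ⟶ B) {x : F.obj A} (hx : x ∈ (c.hom A).source) :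
    F.map ρ x ∈ (c.hom B).source := by
  rw [c.source_eq] at hx ⊢
  have h : F.map B.aug (F.map ρ x) = F.map A.aug x := by
    rw [← Gr.aug_unique (ρ ≫ B.aug) A.aug]; simp
  change F.map B.aug (F.map ρ x) ∈ (c.hom Gr.real).source
  rw [h]
  exact hx

theorem map_symm {A B : Gr} (ρ : A ⟶ B) {y : Pt c.par A.gens} (hy : y ∈ (c.hom A).target) :
    F.map ρ ((c.hom A).symm y) = (c.hom B).symm (Pt.map c.par ρ y) := by
  have hs := (c.hom A).map_target hy
  have h := c.natural ρ _ hs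
  rw [(c.hom A).right_inv hy] at h
  rw [← h, (c.hom B).left_inv (c.map_mem_source ρ hs)]

end SuperChart

namespace SuperManifold

/-- The functor of points of a supermanifold, as a functor to sets. -/
abbrev grSet (M : SuperManifold.{u}) : GrSet.{u} where
  pts := M.Pts
  map := M.mapPts
  map_id := M.mapPts_id
  map_comp := M.mapPts_comp

variable {M : SuperManifold.{u}} {L : Gr}

/-! ### Deformations of a supermanifold, read in charts -/

theorem mem_source_iff_of_map_aug {A : Gr} (c : SuperChart M.F) {x y : M.Pts A}
    (h : M.mapPts A.aug x = M.mapPts A.aug y) :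
    x ∈ (c.hom A).source ↔ y ∈ (c.hom A).source := by
  rw [c.source_eq]
  change M.mapPts A.aug x ∈ (c.hom Gr.real).source ↔ M.mapPts A.aug y ∈ (c.hom Gr.real).source
  rw [h]

theorem deform_mem_source (q : Deform L M.grSet) (c : SuperChart M.F) {A : Gr} (p : L ⟶ A)
    {x : M.Pts A} : q.app A (p, x) ∈ (c.hom A).source ↔ x ∈ (c.hom A).source :=
  mem_source_iff_of_map_aug c (q.map_aug p x)

theorem iterate_mem_source (q : Deform L M.grSet) (c : SuperChart M.F) {A : Gr} (p : L ⟶ A)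
    {x : M.Pts A} (hx : x ∈ (c.hom A).source) (i : ℕ) :
    (fun y => q.app A (p, y))^[i] x ∈ (c.hom A).source := by
  induction i with
  | zero => exact hx
  | succ i ih =>
    rw [Function.iterate_succ_apply']
    exact (deform_mem_source q c p).2 ih

/-- A deformation of `M` in a chart. -/
def chartDeform (q : Deform L M.grSet) (c : SuperChart M.F) :
    Deform L (domain c.par (c.hom Gr.real).target) where
  app A z := ⟨c.hom A (q.app A (z.1, (c.hom A).symm z.2.1)), by
    have hy : z.2.1 ∈ (c.hom A).target := by rw [c.target_eq]; exact z.2.2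
    have h := (c.hom A).map_source ((deform_mem_source q c z.1).2 ((c.hom A).map_target hy))
    rwa [c.target_eq] at h⟩
  natural {A B} ρ p y := by
    have hy : y.1 ∈ (c.hom A).target := by rw [c.target_eq]; exact y.2
    apply Subtype.ext
    change c.hom B (q.app B (p ≫ ρ, (c.hom B).symm (Pt.map c.par ρ y.1))) =
      Pt.map c.par ρ (c.hom A (q.app A (p, (c.hom A).symm y.1)))
    rw [← c.map_symm ρ hy, ← c.natural ρ _
      ((deform_mem_source q c p).2 ((c.hom A).map_target hy))]
    exact congrArg _ (q.natural ρ p _)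
  app_triv A y := by
    have hy : y.1 ∈ (c.hom A).target := by rw [c.target_eq]; exact y.2
    apply Subtype.ext
    change c.hom A (q.app A (Gr.triv L A, (c.hom A).symm y.1)) = y.1
    rw [q.app_triv]
    exact (c.hom A).right_inv hy

/-- A point in the domain of a chart, in coordinates. -/
def chartPt (c : SuperChart M.F) {A : Gr} (x : M.Pts A) (hx : x ∈ (c.hom A).source) :
    (domain c.par (c.hom Gr.real).target).pts A :=
  ⟨c.hom A x, by have h := (c.hom A).map_source hx; rwa [c.target_eq] at h⟩

/-- Replaces iterates in the chart by iterates on `M`. The latter come from morphisms, so the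
inversion formula will visibly be continuous and supersmooth. -/
theorem chartDeform_iterate (q : Deform L M.grSet) (c : SuperChart M.F) {A : Gr} (p : L ⟶ A)
    {x : M.Pts A} (hx : x ∈ (c.hom A).source) (i : ℕ) :
    (fun y => (chartDeform q c).app A (p, y))^[i] (chartPt c x hx) =
      chartPt c ((fun y => q.app A (p, y))^[i] x) (iterate_mem_source q c p hx i) := by
  induction i with
  | zero => rfl
  | succ i ih =>
    rw [Function.iterate_succ_apply', ih]
    apply Subtype.ext
    change c.hom A (q.app A (p, (c.hom A).symm (c.hom A ((fun y => q.app A (p, y))^[i] x)))) =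
      c.hom A ((fun y => q.app A (p, y))^[i + 1] x)
    rw [(c.hom A).left_inv (iterate_mem_source q c p hx i), Function.iterate_succ_apply']

theorem chartDeform_inv_val (q : Deform L M.grSet) (c : SuperChart M.F) {A : Gr} (p : L ⟶ A)
    {x : M.Pts A} (hx : x ∈ (c.hom A).source) :
    ((chartDeform q c).inv.app A (p, chartPt c x hx)).1 =
      ∑ i ∈ Finset.range ((invPoly L.gens).natDegree + 1), (invPoly L.gens).coeff i •
        c.hom A ((fun y => q.app A (p, y))^[i] x) := by
  change (chartDeform q c).invVal A _ = _
  rw [Deform.invVal]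
  simp only [chartDeform_iterate q c p hx]
  rfl

theorem deform_injective (q : Deform L M.grSet) {A : Gr} (p : L ⟶ A) :
    Function.Injective fun x : M.Pts A => q.app A (p, x) := by
  intro x y hxy
  obtain ⟨c, hc, hx⟩ := M.exists_chart x
  -- A chart around `x` also contains `y`, since `q` preserves membership in chart domains in both
  -- directions.
  have hy : y ∈ (c.hom A).source := by
    rw [← deform_mem_source q c p] at hx ⊢
    exact (congrArg (· ∈ (c.hom A).source) hxy).mp hx
  have h : ∀ (x : M.Pts A) (hx : x ∈ (c.hom A).source),
      (chartDeform q c).inv.app A (p, chartPt c (q.app A (p, x))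
        ((deform_mem_source q c p).2 hx)) = chartPt c x hx := fun x hx => by
    rw [← (chartDeform q c).inv_app_app A p (chartPt c x hx)]
    congr 2
    exact (chartDeform_iterate q c p hx 1).symm
  have h2 : chartPt c x hx = chartPt c y hy := by
    rw [← h x hx, ← h y hy]
    congr 2
    exact Subtype.ext (congrArg (c.hom A) hxy)
  exact (c.hom A).injOn hx hy (congrArg Subtype.val h2)

theorem deform_chart_inv (q : Deform L M.grSet) (c : SuperChart M.F) {A : Gr} (p : L ⟶ A)
    {x : M.Pts A} (hx : x ∈ (c.hom A).source) :
    (∑ i ∈ Finset.range ((invPoly L.gens).natDegree + 1), (invPoly L.gens).coeff i •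
      c.hom A ((fun y => q.app A (p, y))^[i] x)) ∈ (c.hom A).target ∧
    q.app A (p, (c.hom A).symm (∑ i ∈ Finset.range ((invPoly L.gens).natDegree + 1),
      (invPoly L.gens).coeff i • c.hom A ((fun y => q.app A (p, y))^[i] x))) = x := by
  rw [← chartDeform_inv_val q c p hx]
  set y := (chartDeform q c).inv.app A (p, chartPt c x hx) with hy
  have hyt : y.1 ∈ (c.hom A).target := by rw [c.target_eq]; exact y.2
  refine ⟨hyt, ?_⟩
  have h := (chartDeform q c).app_inv_app A p (chartPt c x hx)
  rw [← hy] at h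
  exact (c.hom A).injOn ((deform_mem_source q c p).2 ((c.hom A).map_target hyt)) hx
    (congrArg Subtype.val h)

theorem deform_bijective (q : Deform L M.grSet) {A : Gr} (p : L ⟶ A) :
    Function.Bijective fun x : M.Pts A => q.app A (p, x) :=
  ⟨deform_injective q p, fun x => by
    obtain ⟨c, hc, hx⟩ := M.exists_chart x
    exact ⟨_, (deform_chart_inv q c p hx).2⟩⟩

/-- The pointwise inverse of a deformation. -/
def deformInv (q : Deform L M.grSet) (A : Gr) (z : (L ⟶ A) × M.Pts A) : M.Pts A :=
  (Equiv.ofBijective _ (deform_bijective q z.1)).symm z.2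

theorem deform_deformInv (q : Deform L M.grSet) {A : Gr} (p : L ⟶ A) (x : M.Pts A) :
    q.app A (p, deformInv q A (p, x)) = x :=
  (Equiv.ofBijective _ (deform_bijective q p)).apply_symm_apply x

theorem deformInv_deform (q : Deform L M.grSet) {A : Gr} (p : L ⟶ A) (x : M.Pts A) :
    deformInv q A (p, q.app A (p, x)) = x :=
  (Equiv.ofBijective _ (deform_bijective q p)).symm_apply_apply x

/-- The global inverse exists pointwise by bijectivity, so no local inverses need to be glued; this
formula only serves to read off its regularity. -/
theorem deformInv_eq (q : Deform L M.grSet) (c : SuperChart M.F) {A : Gr} (p : L ⟶ A)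
    {x : M.Pts A} (hx : x ∈ (c.hom A).source) :
    deformInv q A (p, x) = (c.hom A).symm
      (∑ i ∈ Finset.range ((invPoly L.gens).natDegree + 1), (invPoly L.gens).coeff i •
        c.hom A ((fun y => q.app A (p, y))^[i] x)) :=
  deform_injective q p ((deform_deformInv q p x).trans (deform_chart_inv q c p hx).2.symm)

/-- A morphism `P(Λ) × M → M` with underlying morphism the identity, as a deformation. -/
def toDeform (q : Hom (prod (superPoint L) M) M)
    (hq : ∀ A x, q.app A ((Gr.triv L A, x) : (L ⟶ A) × M.Pts A) = x) : Deform L M.grSet where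
  app A z := q.app A z
  natural ρ p x := q.natural ρ (p, x)
  app_triv := hq

/-- The powers of a `Λ`-point of `Hom(M, M)`. -/
def iter (q : Hom (prod (superPoint L) M) M) : ℕ → Hom (prod (superPoint L) M) M
  | 0 => Hom.snd _ _
  | k + 1 => innerComp q (iter q k)

theorem iter_app (q : Hom (prod (superPoint L) M) M) (k : ℕ) {A : Gr} (p : L ⟶ A)
    (x : M.Pts A) : (iter q k).app A ((p, x) : (L ⟶ A) × M.Pts A) =
      (fun y => q.app A ((p, y) : (L ⟶ A) × M.Pts A))^[k] x := by
  induction k with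
  | zero => rfl
  | succ k ih =>
    rw [Function.iterate_succ_apply', ← ih]
    rfl

theorem superSmooth_sum_smul {n : ℕ} {E : Type*} [NormedAddCommGroup E] [NormedSpace ℝ E]
    [EvenAction n E] {ι : Type} [Fintype ι] {par : ι → ZMod 2} (s : Finset ℕ) (a : ℕ → ℝ)
    {f : ℕ → E → Pt par n} {x : E} (hf : ∀ i, IsSuperSmoothAt n (f i) x) :
    IsSuperSmoothAt n (fun y => ∑ i ∈ s, a i • f i y) x := by
  refine IsSuperSmoothAt.pi fun k => superSmooth_of_val ?_
  -- Real scalars are written as multiplication by constants of `Λ`, so that closure under sums and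
  -- products applies.
  have h : ∀ y, ((∑ i ∈ s, a i • f i y) k : Grassmann n) =
      ∑ i ∈ s, algebraMap ℝ _ (a i) * (f i y k : Grassmann n) := fun y => by
    simp [Finset.sum_apply, Algebra.smul_def]
  simp only [h]
  clear h
  induction s using Finset.induction_on with
  | empty => exact IsSuperSmoothAt.const _ (fun a => mul_zero _) x
  | insert i s hi ih =>
    simp only [Finset.sum_insert hi]
    refine IsSuperSmoothAt.add (IsSuperSmoothAt.mul
      (IsSuperSmoothAt.const _ (fun a => mul_zero _) x) ?_) ih
    exact (superSmooth_val (f i x k)).comp x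
      (IsSuperSmoothAt.comp (g := fun y : Pt par n => y k) x (superSmooth_coord par k _) (hf i))

/-! ### Inverses -/

section Inverse

variable (q : Hom (prod (superPoint L) M) M)
  (hq : ∀ A x, q.app A ((Gr.triv L A, x) : (L ⟶ A) × M.Pts A) = x)

/-- The inverse of a deformation, in coordinates. -/
def invCoord (c : SuperChart M.F) (A : Gr) (z : (prod (superPoint L) M).Pts A) :
    Pt c.par A.gens :=
  ∑ i ∈ Finset.range ((invPoly L.gens).natDegree + 1), (invPoly L.gens).coeff i •
    c.hom A ((iter q i).app A z)

theorem deformInv_eq_invCoord (c : SuperChart M.F) {A : Gr} (z : (prod (superPoint L) M).Pts A)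
    (hz : z.2 ∈ (c.hom A).source) :
    invCoord q c A z ∈ (c.hom A).target ∧
      deformInv (toDeform q hq) A z = (c.hom A).symm (invCoord q c A z) := by
  have h : invCoord q c A z =
      ∑ i ∈ Finset.range ((invPoly L.gens).natDegree + 1), (invPoly L.gens).coeff i •
        c.hom A ((fun y => (toDeform q hq).app A (z.1, y))^[i] z.2) :=
    Finset.sum_congr rfl fun i _ => by
      rw [show (iter q i).app A z = _ from iter_app q i z.1 z.2]; rfl
  rw [h]
  exact ⟨(deform_chart_inv (toDeform q hq) c z.1 hz).1, deformInv_eq _ c z.1 hz⟩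

theorem iter_mem_source
    (hq : ∀ A x, q.app A ((Gr.triv L A, x) : (L ⟶ A) × M.Pts A) = x)
    (c : SuperChart M.F) {A : Gr} (z : (prod (superPoint L) M).Pts A)
    (hz : z.2 ∈ (c.hom A).source) (i : ℕ) : (iter q i).app A z ∈ (c.hom A).source := by
  rw [show (iter q i).app A z = _ from iter_app q i z.1 z.2]
  exact iterate_mem_source (toDeform q hq) c z.1 hz i

theorem eventually_mem_source (c : SuperChart M.F) {A : Gr} {z : (prod (superPoint L) M).Pts A}
    (hz : z.2 ∈ (c.hom A).source) :
    ∀ᶠ y : (prod (superPoint L) M).Pts A in 𝓝 z, y.2 ∈ (c.hom A).source :=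
  ((c.hom A).open_source.preimage ((Hom.snd (superPoint L) M).continuous_app A)).mem_nhds hz

theorem continuous_deformInv (A : Gr) :
    Continuous (fun z : (prod (superPoint L) M).Pts A => deformInv (toDeform q hq) A z) := by
  refine continuous_iff_continuousAt.2 fun z => ?_
  obtain ⟨c, hc, hz⟩ := M.exists_chart z.2
  have h0 : ∀ i, ContinuousAt (fun y => c.hom A ((iter q i).app A y)) z := fun i =>
    ContinuousAt.comp (g := c.hom A) ((c.hom A).continuousAt (iter_mem_source q hq c z hz i))
      ((iter q i).continuous_app A).continuousAt
  have h1 : ContinuousAt (invCoord q c A) z :=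
    tendsto_finsetSum _ fun i _ => Filter.Tendsto.const_smul (h0 i) _
  have h2 : ContinuousAt ((c.hom A).symm ∘ invCoord q c A) z :=
    ((c.hom A).continuousAt_symm (deformInv_eq_invCoord q hq c z hz).1).comp h1
  refine h2.congr ?_
  filter_upwards [eventually_mem_source c hz] with y hy
  exact (deformInv_eq_invCoord q hq c y hy).2.symm

/-- The inverse of a morphism `P(Λ) × M → M` with underlying morphism the identity. -/
def invHom : Hom (prod (superPoint L) M) M where
  app A z := deformInv (toDeform q hq) A z
  continuous_app := continuous_deformInv q hq
  natural {A B} ρ z := by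
    -- Naturality of the inverse is checked after applying the injective map `q(p ≫ ρ, ·)`; there it
    -- becomes naturality of `q`.
    refine deform_injective (toDeform q hq) (A := B) (show L ⟶ B from z.1 ≫ ρ) ?_
    refine (deform_deformInv (toDeform q hq) (A := B) (z.1 ≫ ρ) (M.mapPts ρ z.2)).trans ?_
    refine Eq.trans ?_ ((toDeform q hq).natural ρ z.1 _).symm
    exact (congrArg (M.mapPts ρ) (deform_deformInv (toDeform q hq) z.1 z.2)).symm
  smooth := by
    rintro _ ⟨b, hb, c, hc, rfl⟩ d hd A z hz hzd
    have hzc : z.2 ∈ (c.hom A).source := hz.2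
    obtain ⟨ht, he⟩ := deformInv_eq_invCoord q hq c z hzc
    -- The target chart may be replaced by the chart `c` around `z.2`: it contains the image as
    -- well, and in it the inverse is the combination of iterates.
    refine smooth_of_chart (M := prod (superPoint L) M) (N := M)
      (continuous_deformInv q hq A) hz hd hc hzd ?_ ?_
    · rw [he]
      exact (c.hom A).map_target ht
    · have hsm : IsSuperSmoothAt A.gens (fun y => ∑ i ∈ Finset.range
          ((invPoly L.gens).natDegree + 1), (invPoly L.gens).coeff i •
            (c.hom A ∘ (iter q i).app A ∘ ((prodChart b c).hom A).symm) y)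
          ((prodChart b c).hom A z) :=
        superSmooth_sum_smul _ _ fun i =>
          (iter q i).smooth _ ⟨b, hb, c, hc, rfl⟩ c hc A z hz (iter_mem_source q hq c z hzc i)
      refine hsm.congr ?_
      have hn : ((prodChart b c).hom A).target ∈ 𝓝 ((prodChart b c).hom A z) :=
        ((prodChart b c).hom A).open_target.mem_nhds (((prodChart b c).hom A).map_source hz)
      filter_upwards [hn] with y hy
      have hs : (((prodChart b c).hom A).symm y : (prod (superPoint L) M).Pts A).2 ∈
        (c.hom A).source := (((prodChart b c).hom A).map_target hy).2
      obtain ⟨ht', he'⟩ := deformInv_eq_invCoord q hq c _ hs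
      simp only [Function.comp_apply]
      refine (congrArg (c.hom A) he').trans ?_
      rw [(c.hom A).right_inv ht']
      rfl

theorem app_invHom (A : Gr) (p : L ⟶ A) (x : M.Pts A) :
    q.app A ((p, (invHom q hq).app A ((p, x) : (L ⟶ A) × M.Pts A)) : (L ⟶ A) × M.Pts A) = x :=
  deform_deformInv (toDeform q hq) p x

theorem invHom_app (A : Gr) (p : L ⟶ A) (x : M.Pts A) :
    (invHom q hq).app A ((p, q.app A ((p, x) : (L ⟶ A) × M.Pts A)) : (L ⟶ A) × M.Pts A) = x :=
  deformInv_deform (toDeform q hq) p x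

end Inverse

/-! ### Invertibility and the underlying morphism -/

theorem underlying_app (φ : (innerHom M M).obj L) (A : Gr) (x : M.Pts A) :
    Hom.app (M := M) (N := M) (underlying φ) A x =
      Hom.app (M := prod (superPoint L) M) (N := M) φ A
        ((Gr.triv L A, x) : (L ⟶ A) × M.Pts A) := rfl

theorem iso_inv_app (χ : M ≅ M) (A : Gr) (x : M.Pts A) :
    Hom.app (M := M) (N := M) χ.inv A (Hom.app (M := M) (N := M) χ.hom A x) = x :=
  congrFun (congrFun (congrArg (Hom.app (M := M) (N := M)) χ.hom_inv_id) A) x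

theorem iso_hom_app (χ : M ≅ M) (A : Gr) (x : M.Pts A) :
    Hom.app (M := M) (N := M) χ.hom A (Hom.app (M := M) (N := M) χ.inv A x) = x :=
  congrFun (congrFun (congrArg (Hom.app (M := M) (N := M)) χ.inv_hom_id) A) x

/-- The composite of `φ` with the inverse of its underlying morphism. -/
def normalize (χ : M ≅ M) (φ : (innerHom M M).obj L) : Hom (prod (superPoint L) M) M :=
  Hom.comp (M := prod (superPoint L) M) (N := M) (P := M) χ.inv φ

theorem normalize_triv {χ : M ≅ M} {φ : (innerHom M M).obj L} (h : χ.hom = underlying φ)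
    (A : Gr) (x : M.Pts A) :
    (normalize χ φ).app A ((Gr.triv L A, x) : (L ⟶ A) × M.Pts A) = x := by
  have h1 := underlying_app φ A x
  rw [← h] at h1
  exact (congrArg (Hom.app (M := M) (N := M) χ.inv A) h1.symm).trans (iso_inv_app χ A x)

/-- Since `φ = χ ∘ q` with `q = normalize χ φ` over the identity, the inverse is `(p, x) ↦ q⁻¹(p,
χ⁻¹ x)`. -/
theorem isInvertible_of_iso {χ : M ≅ M} {φ : (innerHom M M).obj L} (h : χ.hom = underlying φ) :
    IsInvertible φ := by
  refine ⟨(invHom (normalize χ φ) (normalize_triv h)).comp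
    (Hom.pair (Hom.fst _ _) (Hom.comp (M := prod (superPoint L) M) (N := M) (P := M) χ.inv
      (Hom.snd _ _))), Hom.ext ?_, Hom.ext ?_⟩
  · funext A z
    obtain ⟨p, x⟩ := z
    have h1 := app_invHom (normalize χ φ) (normalize_triv h) A p
      (Hom.app (M := M) (N := M) χ.inv A x)
    have h2 := congrArg (Hom.app (M := M) (N := M) χ.hom A) h1
    rw [iso_hom_app] at h2
    exact (iso_hom_app χ A _).symm.trans h2
  · funext A z
    obtain ⟨p, x⟩ := z
    exact invHom_app (normalize χ φ) (normalize_triv h) A p x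

/-- Restriction to the trivial point of `P(Λ)` is compatible with composition, so an inverse of `φ`
restricts to one of `φ_ℝ`. -/
theorem isIso_underlying {φ : (innerHom M M).obj L} (h : IsInvertible φ) :
    IsIso (underlying φ) := by
  obtain ⟨ψ, h1, h2⟩ := h
  refine ⟨underlying (M := M) (L := L) ψ, Hom.ext ?_, Hom.ext ?_⟩
  · funext A x
    exact congrFun (congrFun (congrArg Hom.app h2) A) ((Gr.triv L A, x) : (L ⟶ A) × M.Pts A)
  · funext A x
    exact congrFun (congrFun (congrArg Hom.app h1) A) ((Gr.triv L A, x) : (L ⟶ A) × M.Pts A)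

theorem isInvertible_iff (φ : (innerHom M M).obj L) :
    IsInvertible φ ↔ IsIso (underlying φ) :=
  ⟨isIso_underlying, fun _ => isInvertible_of_iso (χ := asIso (underlying φ)) rfl⟩

theorem sDiff_eq (M : SuperManifold.{u}) : SDiff M = restrict (innerHom M M) (AutSet M) := by
  apply Subfunctor.ext
  funext L
  ext φ
  exact isInvertible_iff φ

end SuperManifold

/-! ### Logarithms of unipotent algebra homomorphisms -/

section Log

open Polynomial

/-- A real polynomial is determined by its values at the natural numbers. -/
theorem polynomial_ext_nat {P Q : ℝ[X]} (h : ∀ s : ℕ, P.eval (s : ℝ) = Q.eval (s : ℝ)) :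
    P = Q :=
  Polynomial.eq_of_infinite_eval_eq P Q
    ((Set.infinite_range_of_injective Nat.cast_injective).mono
      (by rintro _ ⟨s, rfl⟩; exact h s))

/-- The polynomial `X (X - 1) ⋯ (X - j + 1) / j!`. -/
def binomPoly (j : ℕ) : ℝ[X] := C ((j.factorial : ℝ)⁻¹) * descPochhammer ℝ j

theorem binomPoly_eval (j s : ℕ) : (binomPoly j).eval (s : ℝ) = s.choose j := by
  rw [binomPoly, eval_mul, eval_C, Nat.cast_choose_eq_descPochhammer_div, div_eq_inv_mul]

theorem natDegree_binomPoly (j : ℕ) : (binomPoly j).natDegree ≤ j := by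
  refine (natDegree_C_mul_le _ _).trans ?_
  rw [descPochhammer_natDegree]

variable {V : Type*} [AddCommGroup V] [Module ℝ V]

/-- The coefficient of `s^k` in `(1 + N)^s`. -/
def powCoeff (N : Module.End ℝ V) (n k : ℕ) : Module.End ℝ V :=
  ∑ j ∈ Finset.range (n + 1), (binomPoly j).coeff k • N ^ j

/-- Binomial theorem, with `s.choose j` regarded as a polynomial in `s`. The degree in `s` is at
most `n`; the range is one longer so that the linear coefficient is in range even for `n = 0`. -/
theorem one_add_pow {N : Module.End ℝ V} {n : ℕ} (hN : N ^ (n + 1) = 0) (s : ℕ) :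
    (1 + N) ^ s = ∑ k ∈ Finset.range (n + 2), (s : ℝ) ^ k • powCoeff N n k := by
  have h1 : (1 + N) ^ s = ∑ j ∈ Finset.range (n + 1), (s.choose j : ℝ) • N ^ j := by
    rw [add_comm, (Commute.one_right N).add_pow]
    have h : ∀ j, N ^ j * 1 ^ (s - j) * (s.choose j : Module.End ℝ V) =
        (s.choose j : ℝ) • N ^ j := fun j => by
      rw [one_pow, mul_one, ← nsmul_eq_mul', Nat.cast_smul_eq_nsmul]
    simp only [h]
    rcases le_total (s + 1) (n + 1) with hs | hs
    · refine Finset.sum_subset (Finset.range_subset_range.2 hs) fun j _ hj => ?_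
      rw [Nat.choose_eq_zero_of_lt (by simpa using hj), Nat.cast_zero, zero_smul]
    · refine (Finset.sum_subset (Finset.range_subset_range.2 hs) fun j _ hj => ?_).symm
      rw [pow_eq_zero_of_le (by simpa using hj) hN, smul_zero]
  rw [h1]
  simp only [powCoeff, Finset.smul_sum, smul_smul]
  rw [Finset.sum_comm]
  refine Finset.sum_congr rfl fun j hj => ?_
  rw [← Finset.sum_smul, ← binomPoly_eval, eval_eq_sum_range' (n := n + 2)]
  · simp only [mul_comm]
  · have := Finset.mem_range.1 hj
    exact (natDegree_binomPoly j).trans_lt (by omega)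

theorem powCoeff_zero {N : Module.End ℝ V} {n : ℕ} (hN : N ^ (n + 1) = 0) :
    powCoeff N n 0 = 1 := by
  have h := one_add_pow hN 0
  rw [Finset.sum_range_succ'] at h
  simpa using h.symm

theorem powCoeff_one (N : Module.End ℝ V) (n : ℕ) : powCoeff N n 1 =
    ∑ j ∈ Finset.range n, (binomPoly (j + 1)).coeff 1 • N ^ (j + 1) := by
  rw [powCoeff, Finset.sum_range_succ']
  simp [binomPoly, coeff_one]

/-- The polynomial `∑_{k < m} a_k X^k`. -/
def sumPoly (m : ℕ) (a : ℕ → ℝ) : ℝ[X] := ∑ k ∈ Finset.range m, C (a k) * X ^ k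

theorem coeff_sumPoly {m k : ℕ} (hk : k < m) (a : ℕ → ℝ) : (sumPoly m a).coeff k = a k := by
  rw [sumPoly, finsetSum_coeff]
  simp [coeff_C_mul, coeff_X_pow, hk]

theorem eval_sumPoly (m : ℕ) (a : ℕ → ℝ) (s : ℝ) :
    (sumPoly m a).eval s = ∑ k ∈ Finset.range m, s ^ k * a k := by
  rw [sumPoly, eval_finsetSum]
  exact Finset.sum_congr rfl fun k _ => by rw [eval_mul, eval_C, eval_pow, eval_X, mul_comm]

/-- The differential equation `d/dt (1 + N)^t = D_1 (1 + N)^t`, obtained from `(1 + N)^(s+t) = (1 +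
N)^s (1 + N)^t`. Linear functionals reduce it to real polynomials, which are determined by their
values at natural numbers. -/
theorem powCoeff_succ {N : Module.End ℝ V} {n : ℕ} (hN : N ^ (n + 1) = 0) {k : ℕ}
    (hk : k ≤ n) : ((k : ℝ) + 1) • powCoeff N n (k + 1) = powCoeff N n 1 * powCoeff N n k := by
  rw [← sub_eq_zero, ← Module.forall_dual_apply_eq_zero_iff ℝ]
  intro f
  rw [map_sub, map_smul, sub_eq_zero, smul_eq_mul]
  set D := powCoeff N n
  let r : ℕ → ℝ[X] := fun i => sumPoly (n + 2) fun j => f (D i * D j)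
  let p : ℝ[X] := sumPoly (n + 2) fun k => f (D k)
  have h : ∀ t : ℕ, p.comp (X + C (t : ℝ)) = sumPoly (n + 2) fun i => (r i).eval (t : ℝ) := by
    intro t
    refine polynomial_ext_nat fun s => ?_
    have h1 := congrArg f (pow_add (1 + N) s t)
    rw [one_add_pow hN, one_add_pow hN, one_add_pow hN, map_sum, Finset.sum_mul, map_sum] at h1
    simp only [map_smul, smul_eq_mul, Nat.cast_add, Finset.mul_sum, map_sum, smul_mul_assoc,
      mul_smul_comm] at h1
    simp only [eval_comp, eval_add, eval_X, eval_C, p, r, eval_sumPoly, Finset.mul_sum]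
    exact h1.trans (Finset.sum_congr rfl fun i _ => Finset.sum_congr rfl fun j _ => by ring)
  -- Compare the coefficients of `s` in `p(s + t) = ∑ s^i r_i(t)`, that is, differentiate at `s =
  -- 0`; then let `t` run through the natural numbers.
  have h2 : derivative p = r 1 := by
    refine polynomial_ext_nat fun t => ?_
    have h3 : (derivative (p.comp (X + C (t : ℝ)))).coeff 0 = _ :=
      congrArg (fun P => (derivative P).coeff 0) (h t)
    simp only [coeff_derivative (sumPoly _ _)] at h3
    rw [coeff_sumPoly (by omega), derivative_comp, coeff_zero_eq_eval_zero] at h3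
    simpa [eval_comp] using h3
  have h4 := congrArg (fun P => P.coeff k) h2
  simp only [coeff_derivative, p, r] at h4
  rw [coeff_sumPoly (by omega), coeff_sumPoly (by omega)] at h4
  rw [← h4, mul_comm]

theorem powCoeff_eq {N : Module.End ℝ V} {n : ℕ} (hN : N ^ (n + 1) = 0) {k : ℕ}
    (hk : k ≤ n + 1) : powCoeff N n k = ((k.factorial : ℝ)⁻¹) • powCoeff N n 1 ^ k := by
  induction k with
  | zero => simp [powCoeff_zero hN]
  | succ k ih =>
    have h := powCoeff_succ hN (show k ≤ n by omega)
    have hk1 : ((k : ℝ) + 1) ≠ 0 := by positivity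
    rw [ih (by omega), mul_smul_comm, ← pow_succ'] at h
    rw [← inv_smul_smul₀ hk1 (powCoeff N n (k + 1)), h, smul_smul, Nat.factorial_succ]
    push_cast
    rw [mul_inv]

theorem powCoeff_top {N : Module.End ℝ V} (n : ℕ) : powCoeff N n (n + 1) = 0 := by
  refine Finset.sum_eq_zero fun j hj => ?_
  rw [coeff_eq_zero_of_natDegree_lt, zero_smul]
  exact (natDegree_binomPoly j).trans_lt (Finset.mem_range.1 hj)

/-- The exponential of the logarithm `powCoeff N n 1` of `1 + N`. -/
theorem sum_powCoeff_one {N : Module.End ℝ V} {n : ℕ} (hN : N ^ (n + 1) = 0) :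
    ∑ k ∈ Finset.range (n + 1), ((k.factorial : ℝ)⁻¹) • powCoeff N n 1 ^ k = 1 + N := by
  have h := one_add_pow hN 1
  -- At `s = 1` the surplus top term of the expansion vanishes.
  rw [Finset.sum_range_succ, powCoeff_top, smul_zero, add_zero, pow_one] at h
  rw [h]
  refine Finset.sum_congr rfl fun k hk => ?_
  rw [← powCoeff_eq hN (Finset.mem_range.1 hk).le, Nat.cast_one, one_pow, one_smul]

/-- The logarithm of an algebra homomorphism is a derivation. -/
theorem powCoeff_one_leibniz {B : Type*} [Ring B] [Algebra ℝ B] (Ψ : B →ₐ[ℝ] B) {n : ℕ}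
    (hN : (Ψ.toLinearMap - 1 : Module.End ℝ B) ^ (n + 1) = 0) (a b : B) :
    powCoeff (Ψ.toLinearMap - 1) n 1 (a * b) =
      powCoeff (Ψ.toLinearMap - 1) n 1 a * b + a * powCoeff (Ψ.toLinearMap - 1) n 1 b := by
  rw [← sub_eq_zero, ← Module.forall_dual_apply_eq_zero_iff ℝ]
  intro f
  rw [map_sub, sub_eq_zero]
  have hpow := one_add_pow hN
  have h0 := powCoeff_zero hN
  set D := powCoeff (Ψ.toLinearMap - 1 : Module.End ℝ B) n
  have hm : ∀ s : ℕ, ((1 + (Ψ.toLinearMap - 1) : Module.End ℝ B) ^ s) (a * b) =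
      ((1 + (Ψ.toLinearMap - 1) : Module.End ℝ B) ^ s) a *
        ((1 + (Ψ.toLinearMap - 1) : Module.End ℝ B) ^ s) b := by
    intro s
    rw [add_sub_cancel]
    induction s with
    | zero => rfl
    | succ s ih =>
      simp only [pow_succ', Module.End.mul_apply, ih]
      exact map_mul Ψ _ _
  -- Both sides of `Ψ^s(ab) = Ψ^s(a) Ψ^s(b)`, tested on `f`, are polynomials in `s`. Since `D 0 =
  -- 1`, their coefficients of `s` are the two sides of the Leibniz rule.
  let p : ℝ[X] := sumPoly (n + 2) fun k => f (D k (a * b))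
  let r : ℝ[X] := ∑ i ∈ Finset.range (n + 2), X ^ i * sumPoly (n + 2) fun j => f (D i a * D j b)
  have h : p = r := by
    refine polynomial_ext_nat fun s => ?_
    have h1 := congrArg f (hm s)
    rw [hpow] at h1
    simp only [LinearMap.sum_apply, LinearMap.smul_apply, map_sum, map_smul, smul_eq_mul,
      Finset.sum_mul, Finset.mul_sum, smul_mul_assoc, mul_smul_comm] at h1
    simp only [p, r, eval_sumPoly, eval_finsetSum, eval_mul, eval_pow, eval_X, Finset.mul_sum]
    rw [h1]
    rw [Finset.sum_comm]
    exact Finset.sum_congr rfl fun i _ => Finset.sum_congr rfl fun j _ => by ring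
  have h2 := congrArg (fun P => P.coeff 1) h
  simp only [p, r] at h2
  rw [coeff_sumPoly (by omega), finsetSum_coeff, Finset.sum_range_succ', Finset.sum_range_succ',
    Finset.sum_eq_zero] at h2
  · rw [pow_zero, one_mul, coeff_sumPoly (by omega), zero_add, pow_one, coeff_X_mul,
      coeff_sumPoly (by omega), h0] at h2
    rw [h2, map_add]
    rfl
  · intro i _
    rw [mul_comm, coeff_mul_X_pow']
    simp

end Log

namespace SuperManifold

variable {M : SuperManifold.{u}} {L : Gr}

/-! ### Coefficients of supersmooth functions -/

/-- A supersmooth function on `P(Λ) × M`, as a family of maps. -/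
def toPar (F : SmoothFun (prod (superPoint L) M)) : GrSet.ParFun L M.grSet :=
  fun A z => F.1 A z

theorem isNat_toPar (F : SmoothFun (prod (superPoint L) M)) : (toPar F).IsNat :=
  fun ρ p x => F.2.1 ρ (p, x)

theorem isNat_fun (f : SmoothFun M) : GrSet.Fun.IsNat (X := M.grSet) f.1 := f.2.1

/-- The inclusion of `V̄(Λ')` in `V̄(Λ' ⊗ Λ) × W̄(Λ' ⊗ Λ)`, as a linear map. -/
def inclPt {κ ι : Type} (par : κ → ZMod 2) (par' : ι → ZMod 2) (A L : Gr) :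
    Pt par' A.gens →ₗ[ℝ] Pt (Sum.elim par par') (A.sum L).gens where
  toFun y := joinPt par par' _ (0, Pt.map par' (Gr.inl A L) y)
  map_add' y z := by
    funext k
    cases k with
    | inl k => exact (add_zero _).symm
    | inr k => exact Subtype.ext (map_add _ _ _)
  map_smul' r y := by
    funext k
    cases k with
    | inl k =>
      change (0 : part (A.sum L).gens (par k)) = r • 0
      exact (smul_zero r).symm
    | inr k => exact Subtype.ext (map_smul _ _ _)

theorem joinPt_eq {κ ι : Type} (par : κ → ZMod 2) (par' : ι → ZMod 2) (A L : Gr)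
    (t : Pt par (A.sum L).gens) (y : Pt par' A.gens) :
    joinPt par par' _ (t, Pt.map par' (Gr.inl A L) y) =
      joinPt par par' _ (t, 0) + inclPt par par' A L y := by
  funext k
  cases k with
  | inl k => exact (add_zero _).symm
  | inr k => exact (zero_add _).symm

/-- With `t` fixed, `y ↦ (t, y)` is affine, so the chain rule applies. Its linear part turns the
action of `a` into that of the image of `a` in `Λ' ⊗ Λ`, and `coef_even_mul` turns it back. -/
theorem superSmooth_coef {κ ι : Type} [Fintype κ] [Fintype ι] (par : κ → ZMod 2)
    (par' : ι → ZMod 2) {A : Gr} {h : Pt (Sum.elim par par') (A.sum L).gens →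
      Grassmann (A.sum L).gens} (t : Pt par (A.sum L).gens) (y : Pt par' A.gens)
    (hh : IsSuperSmoothAt (A.sum L).gens h (joinPt par par' _ (t, Pt.map par' (Gr.inl A L) y)))
    (I : Finset (Fin L.gens)) :
    IsSuperSmoothAt A.gens
      (fun y => coef I (h (joinPt par par' _ (t, Pt.map par' (Gr.inl A L) y)))) y := by
  let G : Pt par' A.gens →L[ℝ] Pt (Sum.elim par par') (A.sum L).gens :=
    LinearMap.toContinuousLinearMap (inclPt par par' A L)
  let K : Grassmann (A.sum L).gens →L[ℝ] Grassmann A.gens :=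
    LinearMap.toContinuousLinearMap (coef I)
  let g : Pt par' A.gens → Pt (Sum.elim par par') (A.sum L).gens :=
    fun y => joinPt par par' _ (t, 0) + G y
  have hg : ∀ y, joinPt par par' _ (t, Pt.map par' (Gr.inl A L) y) = g y :=
    joinPt_eq par par' A L t
  simp only [hg] at hh ⊢
  have hgd : HasFDerivAt g G y := G.hasFDerivAt.const_add _
  have hgc : ContDiffAt ℝ ∞ g y := contDiffAt_const.add G.contDiff.contDiffAt
  refine ⟨K.contDiff.contDiffAt.comp y (hh.contDiffAt.comp y hgc), fun a v => ?_⟩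
  have hd : HasFDerivAt (fun y => coef I (h (g y))) (K ∘L (fderiv ℝ h (g y) ∘L G)) y :=
    K.hasFDerivAt.comp y (hh.diff.hasFDerivAt.comp y hgd)
  rw [hd.fderiv]
  let b : EvenPart (A.sum L).gens :=
    ⟨Gr.alg (Gr.inl A L) a, Gr.alg_mem (Gr.inl A L) (mem_even_iff.1 a.2)⟩
  have hG : G (EvenAction.act a v) = EvenAction.act b (G v) := by
    funext k
    cases k with
    | inl k => exact Subtype.ext (mul_zero _).symm
    | inr k => exact Subtype.ext (map_mul _ _ _)
  change coef I (fderiv ℝ h (g y) (G (EvenAction.act a v))) =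
    (a : Grassmann A.gens) * coef I (fderiv ℝ h (g y) (G v))
  rw [hG, hh.map_smul]
  exact coef_even_mul (mem_even_iff.1 a.2) I _

/-- The coefficient of `τ_I` of a supersmooth function on `P(Λ) × M`. -/
def smoothCoef (I : Finset (Fin L.gens)) :
    SmoothFun (prod (superPoint L) M) →ₗ[ℝ] SmoothFun M where
  toFun F := ⟨coefFun I (toPar F), coefFun_natural (isNat_toPar F) I, fun c hc A x hx => by
    have hx' := c.map_mem_source (Gr.inl A L) hx
    -- Supersmoothness of `F` over `Λ' ⊗ Λ` at the generic point, in the product chart.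
    have h : IsSuperSmoothAt (A.sum L).gens
        (F.1 (A.sum L) ∘ ((prodChart (pointChart L) c).hom (A.sum L)).symm)
        (joinPt _ _ _ (homEquiv L (A.sum L) (Gr.inr A L),
          c.hom (A.sum L) (M.F.map (Gr.inl A L) x))) :=
      F.2.2 (prodChart (pointChart L) c) ⟨_, rfl, c, hc, rfl⟩ (A.sum L)
        ((Gr.inr A L, M.mapPts (Gr.inl A L) x) : (L ⟶ A.sum L) × M.Pts (A.sum L)) ⟨trivial, hx'⟩
    rw [c.natural _ _ hx] at h
    refine (superSmooth_coef (L := L) _ _ _ _ h I).congr ?_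
    filter_upwards [(c.hom A).open_target.mem_nhds ((c.hom A).map_source hx)] with y hy
    change coef I (F.1 (A.sum L) (Gr.inr A L, M.F.map (Gr.inl A L) ((c.hom A).symm y))) =
      coef I (F.1 (A.sum L) ((homEquiv L (A.sum L)).symm (homEquiv L (A.sum L) (Gr.inr A L)),
        (c.hom (A.sum L)).symm (Pt.map c.par (Gr.inl A L) y)))
    rw [Equiv.symm_apply_apply, c.map_symm _ hy]⟩
  map_add' F G := by
    apply Subtype.ext
    funext A x
    exact map_add _ _ _
  map_smul' r F := by
    apply Subtype.ext
    funext A x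
    exact map_smul (coef (A := A) (L := L) I) r (F.1 (A.sum L) _)

/-- The pullback of functions along `P(Λ) × M → M`. -/
abbrev pullSnd (L : Gr) (M : SuperManifold.{u}) :
    SmoothFun M →ₐ[ℝ] SmoothFun (prod (superPoint L) M) :=
  pullback (Hom.snd (superPoint L) M)

/-- The function on `P(Λ) × M` given by an element of `Λ`. -/
abbrev pullPoint (L : Gr) (M : SuperManifold.{u}) (a : Grassmann L.gens) :
    SmoothFun (prod (superPoint L) M) :=
  pullback (Hom.fst (superPoint L) M) (pointFun L a)

theorem pullPoint_mul (a b : Grassmann L.gens) :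
    pullPoint L M (a * b) = pullPoint L M a * pullPoint L M b := by
  apply Subtype.ext
  funext A z
  exact map_mul _ _ _

theorem fromTensor_tmul (a : Grassmann L.gens) (f : SmoothFun M) :
    fromTensor L M (a ⊗ₜ f) = pullPoint L M a * pullSnd L M f := by
  simp [fromTensor]

theorem fromTensor_one_tmul (f : SmoothFun M) :
    fromTensor L M (1 ⊗ₜ f) = pullSnd L M f := by
  rw [fromTensor_tmul]
  apply Subtype.ext
  funext A z
  exact (congrArg (· * _) (map_one _)).trans (one_mul _)

theorem sum_val {ι : Type*} (s : Finset ι) (f : ι → SmoothFun M) (A : Gr) (x : M.Pts A) :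
    (∑ i ∈ s, f i).1 A x = ∑ i ∈ s, (f i).1 A x := by
  rw [AddSubmonoidClass.coe_finsetSum, Finset.sum_apply, Finset.sum_apply]

theorem sum_smoothCoef (F : SmoothFun (prod (superPoint L) M)) :
    ∑ I, pullPoint L M (tau I) * pullSnd L M (smoothCoef I F) = F := by
  apply Subtype.ext
  funext A z
  obtain ⟨p, x⟩ := z
  have h := sum_coefFun (isNat_toPar F) A p x
  exact (sum_val _ _ A _).trans h.symm

theorem smoothCoef_eq {F : SmoothFun (prod (superPoint L) M)}
    {f : Finset (Fin L.gens) → SmoothFun M}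
    (h : F = ∑ I, pullPoint L M (tau I) * pullSnd L M (f I)) (I : Finset (Fin L.gens)) :
    smoothCoef I F = f I := by
  apply Subtype.ext
  refine coefFun_eq (F := toPar F) (f := fun I => (f I).1) (fun I => isNat_fun _)
    (fun A p x => ?_) I
  have h1 := congrFun (congrFun (congrArg Subtype.val h) A) (p, x)
  exact h1.trans (sum_val _ _ A _)

theorem smoothCoef_empty (F : SmoothFun (prod (superPoint L) M)) (A : Gr) (x : M.Pts A) :
    (smoothCoef ∅ F).1 A x = F.1 A ((Gr.triv L A, x) : (L ⟶ A) × M.Pts A) :=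
  coefFun_empty (isNat_toPar F) A x

theorem smoothCoef_isHomog {j : ZMod 2} {F : SmoothFun (prod (superPoint L) M)}
    (hF : IsHomog j F) (I : Finset (Fin L.gens)) : IsHomog (I.card + j) (smoothCoef I F) :=
  fun A _ => coef_mem_part (hF (A.sum L) _) I

/-! ### The logarithm of a deformation -/

section Log

variable (q : Hom (prod (superPoint L) M) M)

/-- The algebra endomorphism given by `(p, x) ↦ (p, q(p, x))`. -/
def pairPull : SmoothFun (prod (superPoint L) M) →ₐ[ℝ] SmoothFun (prod (superPoint L) M) :=
  pullback (Hom.pair (Hom.fst _ _) q)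

theorem pairPull_pullPoint_mul (a : Grassmann L.gens) (F : SmoothFun (prod (superPoint L) M)) :
    pairPull q (pullPoint L M a * F) = pullPoint L M a * pairPull q F := by
  rw [map_mul]
  rfl

theorem pairPull_pullSnd (f : SmoothFun M) : pairPull q (pullSnd L M f) = pullback q f := rfl

/-- The nilpotent part of `pairPull q`. -/
def nilPull : Module.End ℝ (SmoothFun (prod (superPoint L) M)) := (pairPull q).toLinearMap - 1

/-- The logarithm of `pairPull q`. -/
def logPull : Module.End ℝ (SmoothFun (prod (superPoint L) M)) := powCoeff (nilPull q) L.gens 1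

theorem logPull_isHomog {j : ZMod 2} {F : SmoothFun (prod (superPoint L) M)}
    (hF : IsHomog j F) : IsHomog j (logPull q F) := by
  have h1 : ∀ F, IsHomog j F → IsHomog j (nilPull q F) := fun F hF A z =>
    Submodule.sub_mem _ (hF A (z.1, q.app A z)) (hF A z)
  have h2 : ∀ k, IsHomog j ((nilPull q ^ k) F) := fun k => by
    induction k with
    | zero => exact hF
    | succ k ih => rw [pow_succ', Module.End.mul_apply]; exact h1 _ ih
  intro A z
  rw [logPull, powCoeff, LinearMap.sum_apply, sum_val]
  exact Submodule.sum_mem _ fun k _ => Submodule.smul_mem _ _ (h2 k A z)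

/-- The logarithm series has no constant term, and `(p, x) ↦ (p, q(p, x))` fixes functions of `p`.
With the Leibniz rule this makes the logarithm `Λ`-linear. -/
theorem logPull_pullPoint (a : Grassmann L.gens) : logPull q (pullPoint L M a) = 0 := by
  have h : nilPull q (pullPoint L M a) = 0 := by
    apply Subtype.ext
    funext A z
    exact sub_self _
  rw [logPull, powCoeff_one, LinearMap.sum_apply]
  refine Finset.sum_eq_zero fun j _ => ?_
  rw [LinearMap.smul_apply, pow_succ, Module.End.mul_apply, h, map_zero, smul_zero]

theorem nilPull_pow_eq_zero
    (hq : ∀ A x, q.app A ((Gr.triv L A, x) : (L ⟶ A) × M.Pts A) = x) :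
    nilPull q ^ (L.gens + 1) = 0 := by
  have h : ∀ k F, toPar ((nilPull q ^ k) F) = (((toDeform q hq).op - 1) ^ k) (toPar F) := by
    intro k F
    induction k with
    | zero => rfl
    | succ k ih => rw [pow_succ', pow_succ', Module.End.mul_apply, Module.End.mul_apply, ← ih]; rfl
  ext F A z
  have h1 := h (L.gens + 1) F
  rw [Deform.sub_one_pow_eq_zero _ (isNat_toPar F)] at h1
  exact congrFun (congrFun h1 A) z

/-- Every term of the logarithm ends with an application of `nilPull q`, whose values vanish at the
trivial point. So no field `X_∅` occurs, and nonempty `I` suffice. -/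
theorem smoothCoef_empty_logPull
    (hq : ∀ A x, q.app A ((Gr.triv L A, x) : (L ⟶ A) × M.Pts A) = x)
    (F : SmoothFun (prod (superPoint L) M)) :
    smoothCoef ∅ (logPull q F) = 0 := by
  rw [logPull, powCoeff_one, LinearMap.sum_apply, map_sum]
  refine Finset.sum_eq_zero fun j _ => ?_
  rw [LinearMap.smul_apply, map_smul, pow_succ', Module.End.mul_apply]
  have h : ∀ F, smoothCoef ∅ (nilPull q F) = 0 := fun F => by
    apply Subtype.ext
    funext A x
    rw [smoothCoef_empty]
    change F.1 A (_, q.app A _) - F.1 A _ = 0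
    exact sub_eq_zero.2 (congrArg (fun y => F.1 A ((Gr.triv L A, y) : (L ⟶ A) × M.Pts A)) (hq A x))
  rw [h, smul_zero]

theorem logPull_mul
    (hq : ∀ A x, q.app A ((Gr.triv L A, x) : (L ⟶ A) × M.Pts A) = x)
    (F G : SmoothFun (prod (superPoint L) M)) :
    logPull q (F * G) = logPull q F * G + F * logPull q G :=
  powCoeff_one_leibniz (pairPull q) (nilPull_pow_eq_zero q hq) F G

end Log

/-! ### The exponential form -/

section Fields

variable (q : Hom (prod (superPoint L) M) M)
  (hq : ∀ A x, q.app A ((Gr.triv L A, x) : (L ⟶ A) × M.Pts A) = x)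

/-- The vector fields which are the coefficients of the logarithm of `pairPull q`. -/
def logField : VectorFieldFamily L M := fun I =>
  { toLin := smoothCoef I.1 ∘ₗ logPull q ∘ₗ (pullSnd L M).toLinearMap
    parity := fun j f hf => smoothCoef_isHomog (logPull_isHomog q fun A z => hf A z.2) I.1
    leibniz := fun j f g hf => by
      -- The sign rule is proved for all `I` at once: expand the ordinary Leibniz rule of the
      -- logarithm in the `τ_I` and use uniqueness of coefficients.
      refine smoothCoef_eq (f := fun I => smoothCoef I (logPull q (pullSnd L M f)) * g +
        (-1 : ℝ) ^ ((I.card : ZMod 2) * j).val •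
          (f * smoothCoef I (logPull q (pullSnd L M g)))) ?_ I.1
      change logPull q (pullSnd L M (f * g)) = _
      rw [map_mul, logPull_mul q hq]
      nth_rewrite 1 [← sum_smoothCoef (logPull q (pullSnd L M f)),
        ← sum_smoothCoef (logPull q (pullSnd L M g))]
      rw [Finset.sum_mul, Finset.mul_sum, ← Finset.sum_add_distrib]
      refine Finset.sum_congr rfl fun I _ => ?_
      rw [map_add, map_mul, map_smul, map_mul, mul_add, mul_smul_comm, mul_assoc]
      congr 1
      rw [← mul_assoc, ← mul_assoc, ← smul_mul_assoc]
      congr 1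
      apply Subtype.ext
      funext A z
      -- The sign of the superderivation arises from moving `f` past `τ_I`.
      have h := part_comm (Gr.alg_mem (show L ⟶ A from z.1) (tau_mem_part I)) (hf A z.2)
      change f.1 A z.2 * Gr.alg (show L ⟶ A from z.1) (tau I) =
        (-1 : ℝ) ^ ((I.card : ZMod 2) * j).val •
          (Gr.alg (show L ⟶ A from z.1) (tau I) * f.1 A z.2)
      rw [h, smul_smul, ← mul_pow]
      simp }

/-- On `a ⊗ f` both sides are `a · log T(f)`, expanded in the `τ_I`. Multiplication by `τ_I` from
the right in `sumOp` keeps `a` in front, so no sign appears. -/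
theorem fromTensor_sumOp (t : Grassmann L.gens ⊗[ℝ] SmoothFun M) :
    fromTensor L M (sumOp (logField q hq) t) = logPull q (fromTensor L M t) := by
  induction t with
  | zero => simp only [map_zero]
  | add t t' ht ht' => simp only [map_add, ht, ht']
  | tmul a f =>
    have h : ∀ I, fromTensor L M
        (TensorProduct.map (LinearMap.mulRight ℝ (tau I))
          (smoothCoef I ∘ₗ logPull q ∘ₗ (pullSnd L M).toLinearMap) (a ⊗ₜ f)) =
        pullPoint L M a * (pullPoint L M (tau I) *
          pullSnd L M (smoothCoef I (logPull q (pullSnd L M f)))) := fun I => by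
      rw [TensorProduct.map_tmul, fromTensor_tmul, LinearMap.mulRight_apply, pullPoint_mul,
        mul_assoc]
      rfl
    rw [fromTensor_tmul, logPull_mul q hq, logPull_pullPoint, zero_mul, zero_add,
      ← sum_smoothCoef (logPull q (pullSnd L M f)), Finset.mul_sum, sumOp, LinearMap.sum_apply,
      map_sum]
    refine (Finset.sum_congr rfl fun I _ => h I.1).trans ?_
    let G : Finset (Fin L.gens) → SmoothFun (prod (superPoint L) M) := fun I =>
      pullPoint L M a * (pullPoint L M (tau I) *
        pullSnd L M (smoothCoef I (logPull q (pullSnd L M f))))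
    have hG : G ∅ = 0 := by
      simp only [G, smoothCoef_empty_logPull q hq, map_zero, mul_zero]
    refine (Finset.sum_subtype (Finset.univ.filter Finset.Nonempty) (by simp) G).symm.trans ?_
    refine Finset.sum_filter_of_ne fun I _ hI => Finset.nonempty_iff_ne_empty.2 ?_
    rintro rfl
    exact hI hG

theorem fromTensor_expOp (t : Grassmann L.gens ⊗[ℝ] SmoothFun M) :
    fromTensor L M (expOp (sumOp (logField q hq)) t) = pairPull q (fromTensor L M t) := by
  have hk : ∀ k, fromTensor L M ((sumOp (logField q hq) ^ k) t) =
      (logPull q ^ k) (fromTensor L M t) := fun k => by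
    induction k with
    | zero => rfl
    | succ k ih =>
      rw [pow_succ', pow_succ', Module.End.mul_apply, Module.End.mul_apply, fromTensor_sumOp, ih]
  have h := congrArg (fun T => T (fromTensor L M t))
    (sum_powCoeff_one (nilPull_pow_eq_zero q hq))
  simp only [expOp, LinearMap.sum_apply, LinearMap.smul_apply, map_sum, map_smul, hk] at h ⊢
  refine h.trans ?_
  have h1 : 1 + nilPull q = (pairPull q).toLinearMap :=
    LinearMap.ext fun F => add_sub_cancel F (pairPull q F)
  rw [h1]
  rfl

end Fields

/-- From `φ = χ ∘ q`, pulling back along `φ` is first pulling back along `χ`, then along `q`; the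
second step is the exponential. -/
theorem hasExpForm_logField {χ : M ≅ M} {φ : (innerHom M M).obj L} (h : χ.hom = underlying φ) :
    HasExpForm φ (logField (normalize χ φ) (normalize_triv h)) := by
  intro f
  rw [fromTensor_expOp, fromTensor_one_tmul, ← h]
  apply Subtype.ext
  funext A z
  exact congrArg (f.1 A) (iso_hom_app χ A _).symm

/-! ### The inverse -/

/-- Multiplication by `a` on `Λ ⊗ C^∞(M)`. -/
def mulTensor (a : Grassmann L.gens) : Module.End ℝ (Grassmann L.gens ⊗[ℝ] SmoothFun M) :=
  TensorProduct.map (LinearMap.mulLeft ℝ a) LinearMap.id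

theorem fromTensor_mulTensor (a : Grassmann L.gens) (t : Grassmann L.gens ⊗[ℝ] SmoothFun M) :
    fromTensor L M (mulTensor a t) = pullPoint L M a * fromTensor L M t := by
  induction t with
  | zero => simp only [map_zero, mul_zero]
  | add t t' ht ht' => simp only [map_add, ht, ht', mul_add]
  | tmul b f =>
    rw [mulTensor, TensorProduct.map_tmul, fromTensor_tmul, fromTensor_tmul,
      LinearMap.mulLeft_apply, pullPoint_mul, mul_assoc, LinearMap.id_apply]

/-- Left multiplication by `a` commutes with right multiplication by `τ_I`, and the fields act on
the other factor. -/
theorem commute_sumOp_mulTensor (X : VectorFieldFamily L M) (a : Grassmann L.gens) :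
    Commute (sumOp X) (mulTensor a) := by
  refine Commute.sum_left _ _ _ fun I _ => ?_
  refine TensorProduct.ext' fun b f => ?_
  simp [mulTensor, mul_assoc]

theorem commute_expOp_mulTensor (X : VectorFieldFamily L M) (a : Grassmann L.gens) :
    Commute (expOp (sumOp X)) (mulTensor a) :=
  Commute.sum_left _ _ _ fun k _ => ((commute_sumOp_mulTensor X a).pow_left k).smul_left _

/-- Each `τ_I` with `I` nonempty raises the order in the generators. Hence the truncated series
`expOp` is the full exponential, for any family `X`. -/
theorem sumOp_pow_eq_zero (X : VectorFieldFamily L M) : sumOp X ^ (L.gens + 1) = 0 := by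
  let S : ℕ → Submodule ℝ (Grassmann L.gens ⊗[ℝ] SmoothFun M) := fun k =>
    Submodule.span ℝ {t | ∃ i ≥ k, ∃ a ∈ LinearMap.range (ExteriorAlgebra.ι ℝ) ^ i, ∃ f,
      t = a ⊗ₜ f}
  have hS : ∀ k, ∀ t ∈ S k, sumOp X t ∈ S (k + 1) := fun k t ht => by
    induction ht using Submodule.span_induction with
    | mem t h =>
      obtain ⟨i, hi, a, ha, f, rfl⟩ := h
      rw [sumOp, LinearMap.sum_apply]
      refine Submodule.sum_mem _ fun I _ => Submodule.subset_span
        ⟨i + I.1.card, add_le_add hi (Finset.card_pos.2 I.2), a * tau I.1, ?_, (X I).toLin f, rfl⟩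
      rw [pow_add]
      exact Submodule.mul_mem_mul ha (tau_mem_pow I.1)
    | zero => rw [map_zero]; exact Submodule.zero_mem _
    | add t t' _ _ ht ht' => rw [map_add]; exact Submodule.add_mem _ ht ht'
    | smul r t _ ht => rw [map_smul]; exact Submodule.smul_mem _ _ ht
  have hpow : ∀ k t, (sumOp X ^ k) t ∈ S k := fun k t => by
    induction k with
    | zero =>
      rw [pow_zero, Module.End.one_apply]
      induction t with
      | zero => exact Submodule.zero_mem _
      | add t t' ht ht' => exact Submodule.add_mem _ ht ht'
      | tmul a f =>
        rw [← (Pi.basisFun ℝ (Fin L.gens)).ExteriorAlgebra.sum_repr a, TensorProduct.sum_tmul]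
        refine Submodule.sum_mem _ fun I _ => ?_
        rw [← tau_eq_basis, ← TensorProduct.smul_tmul']
        exact Submodule.smul_mem _ _ (Submodule.subset_span
          ⟨_, Nat.zero_le _, _, tau_mem_pow I, f, rfl⟩)
    | succ k ih => rw [pow_succ', Module.End.mul_apply]; exact hS k _ ih
  refine LinearMap.ext fun t => ?_
  have ht := hpow (L.gens + 1) t
  refine (Submodule.mem_bot ℝ).1 (Submodule.span_le.2 ?_ ht)
  rintro _ ⟨i, hi, a, ha, f, rfl⟩
  rw [eq_zero_of_mem_pow (Nat.lt_of_succ_le hi) ha, TensorProduct.zero_tmul]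
  exact Submodule.zero_mem _

theorem expOp_mul_expOp_neg (X : VectorFieldFamily L M) :
    expOp (sumOp X) * expOp (-sumOp X) = 1 := by
  -- `IsNilpotent.exp` is formed with rational scalars; these act through the reals.
  let : Module ℚ (Module.End ℝ (Grassmann L.gens ⊗[ℝ] SmoothFun M)) :=
    Module.compHom _ (algebraMap ℚ ℝ)
  have h : ∀ D : Module.End ℝ (Grassmann L.gens ⊗[ℝ] SmoothFun M), D ^ (L.gens + 1) = 0 →
      expOp D = IsNilpotent.exp D := fun D hD => by
    rw [IsNilpotent.exp_eq_sum hD, expOp]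
    refine Finset.sum_congr rfl fun k _ => ?_
    change _ = (algebraMap ℚ ℝ ((k.factorial : ℚ)⁻¹)) • D ^ k
    simp
  have h1 := sumOp_pow_eq_zero X
  have h2 : (-sumOp X) ^ (L.gens + 1) = 0 := by
    have := neg_pow (sumOp X) (L.gens + 1)
    rw [this, h1, mul_zero]
  rw [h _ h1, h _ h2]
  exact IsNilpotent.exp_mul_exp_neg_self ⟨_, h1⟩

/-- Both sides are `Λ`-linear in `t`, so `HasExpForm`, which concerns `1 ⊗ f`, determines them. -/
theorem pairPull_fromTensor {φ : Hom (prod (superPoint L) M) M} {X : VectorFieldFamily L M}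
    (hX : HasExpForm φ X) (t : Grassmann L.gens ⊗[ℝ] SmoothFun M) :
    pairPull φ (fromTensor L M t) = fromTensor L M (expOp (sumOp X)
      (LinearMap.lTensor _ (pullback (M := M) (N := M) (underlying (L := L) φ)).toLinearMap t)) := by
  induction t with
  | zero => simp only [map_zero]
  | add t t' ht ht' => simp only [map_add, ht, ht']
  | tmul a f =>
    rw [fromTensor_tmul, pairPull_pullPoint_mul, pairPull_pullSnd, hX f, ← fromTensor_mulTensor,
      ← Module.End.mul_apply, ← (commute_expOp_mulTensor X a).eq, Module.End.mul_apply]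
    simp [mulTensor]

/-- For `t = φ_0⁻¹ (exp(-D) (1 ⊗ f))`, pulling back along `φ` gives `exp(D) exp(-D) (1 ⊗ f) = 1 ⊗
f`. Pulling back along `ψ` undoes this, so `ψ` sends `f` to `t`. -/
theorem pullback_inverse {χ : M ≅ M} {φ ψ : Hom (prod (superPoint L) M) M}
    (h : χ.hom = underlying (L := L) φ)
    (hψ : IsInverse φ ψ) {X : VectorFieldFamily L M} (hX : HasExpForm φ X) (f : SmoothFun M) :
    pullback ψ f = fromTensor L M
      (LinearMap.lTensor (Grassmann L.gens) (pullback (M := M) (N := M) χ.inv).toLinearMap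
        (expOp (-sumOp X) (1 ⊗ₜ[ℝ] f))) := by
  have h1 : ∀ F, pairPull ψ (pairPull φ F) = F := fun F => by
    apply Subtype.ext
    funext A z
    exact congrArg (fun y => F.1 A ((z.1, y) : (L ⟶ A) × M.Pts A))
      (congrFun (congrFun (congrArg Hom.app hψ.1) A) z)
  have h2 : (pullback (M := M) (N := M) (underlying (L := L) φ)).toLinearMap ∘ₗ
      (pullback (M := M) (N := M) χ.inv).toLinearMap = LinearMap.id := by
    refine LinearMap.ext fun g => Subtype.ext ?_
    funext A x
    rw [← h]
    exact congrArg (g.1 A) (iso_inv_app χ A x)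
  rw [← h1 (fromTensor L M _), pairPull_fromTensor hX, ← LinearMap.lTensor_comp_apply, h2,
    LinearMap.lTensor_id, LinearMap.id_apply,
    ← Module.End.mul_apply, expOp_mul_expOp_neg, Module.End.one_apply, fromTensor_one_tmul,
    pairPull_pullSnd]

end SuperManifold

end SuperGeo

end

/-! ### The theorem -/

theorem mainTheorem4 (M : SuperGeo.SuperManifold) :
    (∀ (L : SuperGeo.Gr) (φ : (SuperGeo.SuperManifold.innerHom M M).obj L),
      (SuperGeo.SuperManifold.IsInvertible φ ↔
        CategoryTheory.IsIso (SuperGeo.SuperManifold.underlying φ)) ∧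
      ∀ χ : CategoryTheory.Iso M M, χ.hom = SuperGeo.SuperManifold.underlying φ →
        (∃ X : SuperGeo.SuperManifold.VectorFieldFamily L M,
          SuperGeo.SuperManifold.HasExpForm φ X) ∧
        ∃ ψ : (SuperGeo.SuperManifold.innerHom M M).obj L,
          SuperGeo.SuperManifold.IsInverse φ ψ ∧
          ∀ X : SuperGeo.SuperManifold.VectorFieldFamily L M,
            SuperGeo.SuperManifold.HasExpForm φ X →
            ∀ f : SuperGeo.SuperManifold.SmoothFun M,
              SuperGeo.SuperManifold.pullback ψ f =
                SuperGeo.SuperManifold.fromTensor L M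
                  (LinearMap.lTensor (SuperGeo.Grassmann L.gens)
                    (SuperGeo.SuperManifold.pullback (M := M) (N := M) χ.inv).toLinearMap
                    (SuperGeo.SuperManifold.expOp (-SuperGeo.SuperManifold.sumOp X)
                      (1 ⊗ₜ[ℝ] f)))) ∧
    SuperGeo.SuperManifold.SDiff M =
      SuperGeo.SuperManifold.restrict (SuperGeo.SuperManifold.innerHom M M)
        (SuperGeo.SuperManifold.AutSet M) := by
  refine ⟨fun L φ => ⟨SuperGeo.SuperManifold.isInvertible_iff φ, fun χ h => ⟨⟨_,
    SuperGeo.SuperManifold.hasExpForm_logField h⟩, ?_⟩⟩, SuperGeo.SuperManifold.sDiff_eq M⟩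
  obtain ⟨ψ, hψ⟩ := SuperGeo.SuperManifold.isInvertible_of_iso h
  exact ⟨ψ, hψ, fun X hX => SuperGeo.SuperManifold.pullback_inverse h hψ hX⟩
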